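/- Write $e(x)=e^{2\pi i x}$ and let $\mathbb H$ be the upper half plane. An integral lattice $\underline L=(L,\beta)$ of rank $n$ is a free $\mathbb Z$-module $L$ of rank $n$ with a symmetric $\mathbb Z$-valued bilinear form $\beta$; put $\beta(x)=\tfrac12\beta(x,x)$, and use $\beta$ also for the extension to $\mathbb Q\otimes L$ and $\mathbb C\otimes L$. It is positive definite if $\beta(x)>0$ for all $0\ne x\in L$, even if $\beta(x,x)$ is even for all $x\in L$, and unimodular if $x\mapsto\beta(x,\cdot)$ is an isomorphism $L\to\mathrm{Hom}(L,\mathbb Z)$. Two integral lattices $\underline L_1,\underline L_2$ are called stably equivalent (resp. even stably equivalent) if there are integral unimodular (resp. even unimodular) lattices $\underline U_1,\underline U_2$, not necessarily definite, such that the orthogonal sums $\underline L_1\perp\underline U_1$ and $\underline L_2\perp\underline U_2$ are isometric. Let $G=\mathrm{Mp}(2,\mathbb Z)$ be the group of pairs $(A,w)$ with $A=\begin{pmatrix}a&b\\c&d\end{pmatrix}\in\mathrm{SL}(2,\mathbb Z)$ and $w$ a holomorphic function on $\mathbb H$ with $w(\tau)^2=c\tau+d$, with multiplication $(A,w)(B,v)=(AB,\,w(B\tau)v(\tau))$.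 Let $\varepsilon(A,w)=\eta(A\tau)/(\eta(\tau)w(\tau))$, where $\eta$ is the Dedekind eta function; this is independent of $\tau$ and a linear character of $G$. For a linear character $\chi$ of $G$ let $\mathbb C(\chi)$ be $\mathbb C$ with $G$ acting through $\chi$. For an integral positive definite lattice $\underline L=(L,\beta)$ of rank $n$ let $$L^\bullet=\{r\in\mathbb Q\otimes L:\ \beta(r,x)\equiv\beta(x)\bmod\mathbb Z\ \text{ for all } x\in L\},$$ let $W(\underline L)$ be the space of maps $\lambda:L^\bullet\to\mathbb C$ such that $\lambda(r+x)=e(\beta(x))\lambda(r)$ for all $r\in L^\bullet$, $x\in L$, and let $\Theta(\underline L)$ be the space of the functions $$\vartheta_{\underline L,\lambda}(\tau,z)=\sum_{r\in L^\bullet}\lambda(r)\,e(\tau\beta(r))\,e(\beta(r,z))\qquad(\tau\in\mathbb H,\ z\in\mathbb C\otimes L),\quad \lambda\in W(\underline L).$$ The group $G$ acts on functions $\phi$ on $\mathbb H\times(\mathbb C\otimes L)$ from the left by $(\alpha,\phi)\mapsto\phi|\alpha^{-1}$, where, for $\alpha=(A,w)$ as above, $$(\phi|\alpha)(\tau,z)=\phi\Big(\frac{a\tau+b}{c\tau+d},\frac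 z{c\tau+d}\Big)\,e\Big(\frac{-c\,\beta(z)}{c\tau+d}\Big)\,w(\tau)^{-n}.$$ **Theorem.** Let $\underline L_1$ and $\underline L_2$ be integral positive definite lattices of rank $n_1$ and $n_2$, respectively. Then $\Theta(\underline L_1)$ and $\Theta(\underline L_2)$ are stable under the action of $G$. If $\underline L_1$ and $\underline L_2$ are stably equivalent, then $$\Theta(\underline L_1)\otimes\mathbb C(\varepsilon^{3n_1})\;\cong\;\Theta(\underline L_2)\otimes\mathbb C(\varepsilon^{3n_2})$$ as $G$-modules. If $\underline L_1$ and $\underline L_2$ are even stably equivalent, then $\Theta(\underline L_1)\cong\Theta(\underline L_2)$ as $G$-modules. -/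

import Mathlib

open UpperHalfPlane TensorProduct
open scoped MatrixGroups Manifold

universe u v

namespace LatticeTheta

noncomputable section

/-! ### The metaplectic cover of the modular group -/

/-- The automorphy factor `c τ + d` of a matrix with lower row `(c, d)`. -/
def autFactor (A : SL(2, ℤ)) (τ : ℍ) : ℂ := (A 1 0 : ℂ) * (τ : ℂ) + (A 1 1 : ℂ)

theorem autFactor_eq_denom (A : SL(2, ℤ)) (τ : ℍ) : autFactor A τ = denom A τ := by
  simp [autFactor, denom]

theorem autFactor_ne_zero (A : SL(2, ℤ)) (τ : ℍ) : autFactor A τ ≠ 0 := by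
  rw [autFactor_eq_denom]; exact denom_ne_zero _ τ

theorem coe_smul_eq (A : SL(2, ℤ)) (τ : ℍ) :
    ((A • τ : ℍ) : ℂ) = ((A 0 0 : ℂ) * τ + (A 0 1 : ℂ)) / autFactor A τ := by
  rw [coe_specialLinearGroup_apply]
  simp [autFactor]

theorem det_eq_one (A : SL(2, ℤ)) : (A 0 0 : ℂ) * (A 1 1 : ℂ) - (A 0 1 : ℂ) * (A 1 0 : ℂ) = 1 := by
  have h := A.det_coe
  rw [Matrix.det_fin_two] at h
  exact_mod_cast h

theorem mul_lower_left (A B : SL(2, ℤ)) :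
    ((A * B) 1 0 : ℂ) = (A 1 0 : ℂ) * (B 0 0 : ℂ) + (A 1 1 : ℂ) * (B 1 0 : ℂ) := by
  simp [Matrix.mul_apply, Fin.sum_univ_two]

theorem mul_lower_right (A B : SL(2, ℤ)) :
    ((A * B) 1 1 : ℂ) = (A 1 0 : ℂ) * (B 0 1 : ℂ) + (A 1 1 : ℂ) * (B 1 1 : ℂ) := by
  simp [Matrix.mul_apply, Fin.sum_univ_two]

theorem autFactor_mul (A B : SL(2, ℤ)) (τ : ℍ) :
    autFactor (A * B) τ = autFactor A (B • τ) * autFactor B τ := by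
  have hB := autFactor_ne_zero B τ
  have h : autFactor A (B • τ) * autFactor B τ =
      (A 1 0 : ℂ) * ((B 0 0 : ℂ) * τ + (B 0 1 : ℂ)) + (A 1 1 : ℂ) * autFactor B τ := by
    rw [autFactor, coe_smul_eq]
    field_simp
  rw [h, autFactor, mul_lower_left, mul_lower_right, autFactor]
  ring

theorem autFactor_one (τ : ℍ) : autFactor 1 τ = 1 := by
  simp [autFactor]

theorem mdifferentiable_sl_smul (A : SL(2, ℤ)) :
    MDiff (fun τ : ℍ ↦ A • τ) :=
  mdifferentiable_smul (g := (A : GL (Fin 2) ℝ)) (by simp)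

/-- The metaplectic cover of `SL(2, ℤ)`: pairs `(A, w)` of a matrix `A` with lower row `(c, d)` and
a holomorphic square root `w` of `τ ↦ c τ + d` on the upper half plane. -/
@[ext]
structure Mp where
  mat : SL(2, ℤ)
  root : ℍ → ℂ
  holo : MDiff root
  root_sq : ∀ τ, root τ ^ 2 = autFactor mat τ

namespace Mp

theorem root_ne_zero (α : Mp) (τ : ℍ) : α.root τ ≠ 0 := by
  intro h
  have := α.root_sq τ
  rw [h] at this
  exact autFactor_ne_zero α.mat τ (by simpa using this.symm)

instance : Mul Mp where
  mul α β :=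
    { mat := α.mat * β.mat
      root := fun τ ↦ α.root (β.mat • τ) * β.root τ
      holo := (α.holo.comp (mdifferentiable_sl_smul β.mat)).mul β.holo
      root_sq := fun τ ↦ by rw [mul_pow, α.root_sq, β.root_sq, autFactor_mul] }

instance : One Mp where
  one :=
    { mat := 1
      root := fun _ ↦ 1
      holo := mdifferentiable_const
      root_sq := fun τ ↦ by rw [autFactor_one, one_pow] }

theorem mdiff_inv {f : ℍ → ℂ} (hf : MDiff f) (h0 : ∀ τ, f τ ≠ 0) : MDiff (fun τ ↦ (f τ)⁻¹) := by
  rw [mdifferentiable_iff] at hf ⊢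
  exact hf.inv fun z _ ↦ h0 _

instance : Inv Mp where
  inv α :=
    { mat := α.mat⁻¹
      root := fun τ ↦ (α.root (α.mat⁻¹ • τ))⁻¹
      holo := mdiff_inv (α.holo.comp (mdifferentiable_sl_smul α.mat⁻¹)) fun τ ↦ α.root_ne_zero _
      root_sq := fun τ ↦ by
        have h := autFactor_mul α.mat α.mat⁻¹ τ
        rw [mul_inv_cancel, autFactor_one] at h
        rw [inv_pow, α.root_sq, inv_eq_of_mul_eq_one_right h.symm] }

@[simp] theorem mat_mul (α β : Mp) : (α * β).mat = α.mat * β.mat := rfl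
@[simp] theorem root_mul (α β : Mp) (τ : ℍ) :
    (α * β).root τ = α.root (β.mat • τ) * β.root τ := rfl
@[simp] theorem mat_one : (1 : Mp).mat = 1 := rfl
@[simp] theorem root_one (τ : ℍ) : (1 : Mp).root τ = 1 := rfl
@[simp] theorem mat_inv (α : Mp) : (α⁻¹).mat = (α.mat)⁻¹ := rfl
@[simp] theorem root_inv (α : Mp) (τ : ℍ) : (α⁻¹).root τ = (α.root (α.mat⁻¹ • τ))⁻¹ := rfl

/-- The multiplication is `(A, w) (B, v) = (A B, w(B τ) v(τ))`. -/
instance : Group Mp :=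
  Group.ofLeftAxioms
    (fun α β γ ↦ by
      ext τ
      · simp [mul_assoc]
      · simp [mul_assoc, mul_smul])
    (fun α ↦ by
      ext τ
      · simp
      · simp)
    (fun α ↦ by
      ext τ
      · simp
      · simp [α.root_ne_zero])

end Mp

/-! ### The character of the Dedekind eta function -/

/-- The quotient `η(A τ) / (η(τ) w(τ))`. -/
def etaQuotient (α : Mp) (τ : ℍ) : ℂ :=
  ModularForm.eta (α.mat • τ : ℍ) / (ModularForm.eta τ * α.root τ)

theorem eta_coe_ne_zero (τ : ℍ) : ModularForm.eta τ ≠ 0 :=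
  ModularForm.eta_ne_zero τ.im_pos

theorem continuous_eta_coe : Continuous fun τ : ℍ ↦ ModularForm.eta τ :=
  continuous_iff_continuousAt.2 fun τ ↦
    (ModularForm.differentiableAt_eta_of_mem_upperHalfPlaneSet τ.im_pos).continuousAt.comp
      UpperHalfPlane.continuous_coe.continuousAt

theorem etaQuotient_pow (α : Mp) (τ : ℍ) : etaQuotient α τ ^ 24 = 1 := by
  have h : ModularForm.eta (α.mat • τ : ℍ) ^ 24 =
      autFactor α.mat τ ^ 12 * ModularForm.eta τ ^ 24 := by
    have := SlashInvariantForm.slash_action_eqn''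
      CuspForm.discriminant (γ := (α.mat : GL (Fin 2) ℝ))
      (MonoidHom.mem_range.2 ⟨α.mat, rfl⟩) τ
    rw [autFactor_eq_denom]
    exact_mod_cast this
  have hw : α.root τ ^ 24 = autFactor α.mat τ ^ 12 := by
    rw [← α.root_sq, ← pow_mul]
  rw [etaQuotient, div_pow, mul_pow, h, hw, mul_comm]
  exact div_self (mul_ne_zero (pow_ne_zero _ (eta_coe_ne_zero τ))
    (pow_ne_zero _ (autFactor_ne_zero _ _)))

theorem continuous_etaQuotient (α : Mp) : Continuous (etaQuotient α) := by
  refine Continuous.div ?_ (continuous_eta_coe.mul α.holo.continuous)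
    fun τ ↦ mul_ne_zero (eta_coe_ne_zero τ) (α.root_ne_zero τ)
  exact continuous_eta_coe.comp (mdifferentiable_sl_smul α.mat).continuous

/-- The quotient `η(A τ) / (η(τ) w(τ))` does not depend on `τ`. -/
theorem etaQuotient_const (α : Mp) (τ σ : ℍ) : etaQuotient α τ = etaQuotient α σ := by
  have hfin : {z : ℂ | z ^ 24 = 1}.Finite := by
    refine (Polynomial.nthRoots 24 (1 : ℂ)).toFinset.finite_toSet.subset fun z hz ↦ ?_
    simpa using (Polynomial.mem_nthRoots (by norm_num)).2 hz
  have hpre : IsPreconnected (Set.range (etaQuotient α)) :=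
    isPreconnected_range (continuous_etaQuotient α)
  have hsub : Set.range (etaQuotient α) ⊆ {z : ℂ | z ^ 24 = 1} := by
    rintro _ ⟨τ, rfl⟩
    exact etaQuotient_pow α τ
  exact hfin.countable.isTotallyDisconnected _ hsub hpre ⟨τ, rfl⟩ ⟨σ, rfl⟩

theorem etaQuotient_mul (α β : Mp) (τ : ℍ) :
    etaQuotient (α * β) τ = etaQuotient α (β.mat • τ) * etaQuotient β τ := by
  have h1 := eta_coe_ne_zero τ
  have h2 := eta_coe_ne_zero (β.mat • τ)
  have h3 := α.root_ne_zero (β.mat • τ)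
  have h4 := β.root_ne_zero τ
  simp only [etaQuotient, Mp.mat_mul, Mp.root_mul, mul_smul]
  field_simp

theorem etaQuotient_one (τ : ℍ) : etaQuotient 1 τ = 1 := by
  simp [etaQuotient, eta_coe_ne_zero]

/-- The linear character `ε(A, w) = η(A τ) / (η(τ) w(τ))`; the quotient is independent of `τ` by
`etaQuotient_const` and is evaluated at `τ = i`. -/
def epsilon : Mp →* ℂˣ :=
  MonoidHom.toHomUnits
    { toFun := fun α ↦ etaQuotient α UpperHalfPlane.I
      map_one' := etaQuotient_one _
      map_mul' := fun α β ↦ by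
        rw [etaQuotient_mul, etaQuotient_const α (β.mat • UpperHalfPlane.I) UpperHalfPlane.I] }

theorem epsilon_apply (α : Mp) (τ : ℍ) : (epsilon α : ℂ) = etaQuotient α τ :=
  etaQuotient_const α _ _

/-- The one-dimensional `Mp`-module `ℂ(χ)` on which `α` acts as multiplication by `χ(α)`. -/
def charRep (χ : Mp →* ℂˣ) : Representation ℂ Mp ℂ where
  toFun α := LinearMap.lsmul ℂ ℂ (χ α : ℂ)
  map_one' := by ext; simp
  map_mul' α β := by ext; simp

/-! ### Integral lattices -/

/-- An integral lattice: a free `ℤ`-module of finite rank with a symmetric `ℤ`-valued `ℤ`-bilinear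
form. -/
structure IntegralLattice where
  carrier : Type u
  [addCommGroup : AddCommGroup carrier]
  [free : Module.Free ℤ carrier]
  [finite : Module.Finite ℤ carrier]
  form : LinearMap.BilinForm ℤ carrier
  symm : ∀ x y, form x y = form y x

namespace IntegralLattice

instance : CoeSort IntegralLattice.{u} (Type u) := ⟨IntegralLattice.carrier⟩

attribute [instance] addCommGroup free finite

/-- The rank of the lattice. -/
def rank (L : IntegralLattice.{u}) : ℕ := Module.finrank ℤ L

def IsPosDef (L : IntegralLattice.{u}) : Prop := ∀ x : L, x ≠ 0 → 0 < L.form x x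

def IsEven (L : IntegralLattice.{u}) : Prop := ∀ x : L, Even (L.form x x)

/-- Unimodularity: the form identifies the lattice with its `ℤ`-dual. -/
def IsUnimodular (L : IntegralLattice.{u}) : Prop :=
  Function.Bijective (L.form : L → Module.Dual ℤ L)

/-- The orthogonal sum of two lattices. -/
def orthSum (L : IntegralLattice.{u}) (M : IntegralLattice.{v}) : IntegralLattice.{max u v} where
  carrier := L × M
  form := L.form.compl₁₂ (LinearMap.fst ℤ L M) (LinearMap.fst ℤ L M) +
    M.form.compl₁₂ (LinearMap.snd ℤ L M) (LinearMap.snd ℤ L M)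
  symm x y := by simp [L.symm x.1 y.1, M.symm x.2 y.2]

theorem orthSum_form (L : IntegralLattice.{u}) (M : IntegralLattice.{v}) (x y : L × M) :
    (L.orthSum M).form x y = L.form x.1 y.1 + M.form x.2 y.2 := rfl

/-- Two lattices are isomorphic if there is an isometric isomorphism of `ℤ`-modules. -/
def Isomorphic (L : IntegralLattice.{u}) (M : IntegralLattice.{v}) : Prop :=
  ∃ e : L ≃ₗ[ℤ] M, ∀ x y : L, M.form (e x) (e y) = L.form x y

/-- Stable equivalence: the lattices become isomorphic after adding unimodular lattices (of
arbitrary signature). Every lattice is isomorphic to one with carrier in `Type`. -/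
def StablyEquivalent (L : IntegralLattice.{u}) (M : IntegralLattice.{v}) : Prop :=
  ∃ U V : IntegralLattice.{0}, U.IsUnimodular ∧ V.IsUnimodular ∧
    (L.orthSum U).Isomorphic (M.orthSum V)

/-- Even stable equivalence: the lattices become isomorphic after adding even unimodular
lattices. -/
def EvenStablyEquivalent (L : IntegralLattice.{u}) (M : IntegralLattice.{v}) : Prop :=
  ∃ U V : IntegralLattice.{0}, (U.IsUnimodular ∧ U.IsEven) ∧ (V.IsUnimodular ∧ V.IsEven) ∧
    (L.orthSum U).Isomorphic (M.orthSum V)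

variable (L : IntegralLattice.{u})

/-- The rational vector space `ℚ ⊗ L`. -/
abbrev RatSpace : Type u := ℚ ⊗[ℤ] L

/-- The complex vector space `ℂ ⊗ L`. -/
abbrev CplxSpace : Type u := ℂ ⊗[ℤ] L

/-- The `ℚ`-bilinear extension of the form. -/
abbrev formQ : LinearMap.BilinForm ℚ L.RatSpace := L.form.baseChange ℚ

/-- The `ℂ`-bilinear extension of the form. -/
abbrev formC : LinearMap.BilinForm ℂ L.CplxSpace := L.form.baseChange ℂ

/-- The inclusion `L → ℚ ⊗ L`. -/
def toRat (x : L) : L.RatSpace := 1 ⊗ₜ x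

/-- The inclusion `ℚ ⊗ L → ℂ ⊗ L`. -/
def toCplx : L.RatSpace →ₗ[ℤ] L.CplxSpace :=
  LinearMap.rTensor L (algebraMap ℚ ℂ).toIntAlgHom.toLinearMap

/-- The shadow of `L`: the vectors `r` in `ℚ ⊗ L` with `β(r, x) ≡ β(x, x) / 2` modulo `ℤ` for all
`x` in `L`. -/
def shadow : Set L.RatSpace :=
  {r | ∀ x : L, ∃ m : ℤ, L.formQ r (L.toRat x) - (L.form x x : ℚ) / 2 = m}

end IntegralLattice

/-! ### Theta functions -/

/-- `e(x) = exp(2 π i x)`. -/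
def e (x : ℂ) : ℂ := Complex.exp (2 * Real.pi * Complex.I * x)

theorem e_add (x y : ℂ) : e (x + y) = e x * e y := by
  rw [e, mul_add, Complex.exp_add, e, e]

theorem e_zero : e 0 = 1 := by simp [e]

namespace IntegralLattice

variable (L : IntegralLattice.{u})

/-- The space of maps `l` from the shadow to `ℂ` with `l(r + x) = e(β(x, x) / 2) l(r)` for all `x`
in `L`. -/
def W : Submodule ℂ (L.shadow → ℂ) where
  carrier := {l | ∀ (r s : L.shadow) (x : L), (s : L.RatSpace) = r + L.toRat x →
    l s = e ((L.form x x : ℂ) / 2) * l r}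
  add_mem' {l m} hl hm r s x h := by
    simp only [Pi.add_apply, hl r s x h, hm r s x h, mul_add]
  zero_mem' r s x h := by simp
  smul_mem' c l hl r s x h := by
    simp only [Pi.smul_apply, hl r s x h, smul_eq_mul]
    ring

/-- The theta function `∑ l(r) q ^ (β(r, r) / 2) e(β(r, z))`, the sum being over all `r` in the
shadow, where `q ^ a = e(a τ)`. -/
def theta (l : L.shadow → ℂ) (τ : ℍ) (z : L.CplxSpace) : ℂ :=
  ∑' r : L.shadow, l r * e ((L.formQ r r / 2 : ℚ) * (τ : ℂ)) * e (L.formC (L.toCplx r) z)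

/-- The space `Θ(L)` of functions on `ℍ × (ℂ ⊗ L)` spanned by the theta functions attached to the
elements of `W(L)`. -/
def Theta : Submodule ℂ (ℍ → L.CplxSpace → ℂ) :=
  Submodule.span ℂ (L.theta '' (L.W : Set (L.shadow → ℂ)))

/-- The slash action of weight `n / 2` and index `L` on functions on `ℍ × (ℂ ⊗ L)`, where `n` is
the rank of `L`: for `α = (A, w)` with lower row `(c, d)` of `A` it sends `φ` to
`φ(A τ, z / (c τ + d)) e(- c β(z, z) / (2 (c τ + d))) w(τ) ^ (- n)`. -/
def slash (φ : ℍ → L.CplxSpace → ℂ) (α : Mp) : ℍ → L.CplxSpace → ℂ := fun τ z ↦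
  φ (α.mat • τ) ((autFactor α.mat τ)⁻¹ • z) *
    e (-(α.mat 1 0 : ℂ) * (L.formC z z / 2) / autFactor α.mat τ) * (α.root τ)⁻¹ ^ L.rank

theorem slash_one (φ : ℍ → L.CplxSpace → ℂ) : L.slash φ 1 = φ := by
  ext τ z
  simp [slash, autFactor_one, e_zero]

theorem slash_mul (φ : ℍ → L.CplxSpace → ℂ) (α β : Mp) :
    L.slash φ (α * β) = L.slash (L.slash φ α) β := by
  ext τ z
  have hA := autFactor_ne_zero α.mat (β.mat • τ)
  have hB := autFactor_ne_zero β.mat τ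
  have hAB := autFactor_mul α.mat β.mat τ
  have key : (α.mat 1 0 : ℂ) + (β.mat 1 0 : ℂ) * (autFactor α.mat (β.mat • τ) * autFactor β.mat τ) =
      ((α.mat * β.mat) 1 0 : ℂ) * autFactor β.mat τ := by
    rw [← hAB, autFactor, mul_lower_left, mul_lower_right, autFactor]
    linear_combination (-(α.mat 1 0 : ℂ)) * det_eq_one β.mat
  simp only [slash, Mp.mat_mul, Mp.root_mul, mul_smul, hAB]
  have h1 : (autFactor α.mat (β.mat • τ) * autFactor β.mat τ)⁻¹ • z =
      (autFactor α.mat (β.mat • τ))⁻¹ • (autFactor β.mat τ)⁻¹ • z := by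
    rw [smul_smul, mul_inv]
  have h2 : e (-((α.mat * β.mat) 1 0 : ℂ) * (L.formC z z / 2) /
        (autFactor α.mat (β.mat • τ) * autFactor β.mat τ)) =
      e (-(α.mat 1 0 : ℂ) * (L.formC ((autFactor β.mat τ)⁻¹ • z) ((autFactor β.mat τ)⁻¹ • z) / 2) /
        autFactor α.mat (β.mat • τ)) *
      e (-(β.mat 1 0 : ℂ) * (L.formC z z / 2) / autFactor β.mat τ) := by
    rw [← e_add]
    congr 1
    simp only [map_smul, LinearMap.smul_apply, smul_eq_mul]
    field_simp
    linear_combination (L.formC z z) * key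
  rw [h1, h2, mul_inv, mul_pow]
  ring

/-- The left action `(α, φ) ↦ φ | α⁻¹` of `Mp` on functions on `ℍ × (ℂ ⊗ L)`. -/
def slashRep : Representation ℂ Mp (ℍ → L.CplxSpace → ℂ) where
  toFun α :=
    { toFun := fun φ ↦ L.slash φ α⁻¹
      map_add' := fun φ ψ ↦ by ext τ z; simp only [slash, Pi.add_apply]; ring
      map_smul' := fun c φ ↦ by
        ext τ z; simp only [slash, Pi.smul_apply, smul_eq_mul, RingHom.id_apply]; ring }
  map_one' := by
    ext φ : 1
    simp [slash_one]
  map_mul' α β := by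
    ext φ : 1
    simp [slash_mul]

end IntegralLattice

end

end LatticeTheta

universe w

namespace LatticeTheta

noncomputable section

/-! ### Exponentials and one-dimensional theta series -/

theorem e_neg (x : ℂ) : e (-x) = (e x)⁻¹ := by
  rw [e, mul_neg, Complex.exp_neg, e]

theorem e_ne_zero (x : ℂ) : e x ≠ 0 := Complex.exp_ne_zero _

theorem e_int (m : ℤ) : e m = 1 := by
  rw [e, Complex.exp_eq_one_iff]
  exact ⟨m, by ring⟩

theorem e_eq_one_iff (x : ℂ) : e x = 1 ↔ ∃ m : ℤ, x = m := by
  rw [e, Complex.exp_eq_one_iff]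
  refine exists_congr fun m ↦ ⟨fun h ↦ ?_, fun h ↦ by rw [h]; ring⟩
  exact mul_left_cancel₀ Complex.two_pi_I_ne_zero (h.trans (mul_comm _ _))

theorem e_eq_of_sub_int {x y : ℂ} (m : ℤ) (h : x - y = m) : e x = e y := by
  rw [← sub_add_cancel x y, h, e_add, e_int, one_mul]

theorem e_sum {ι : Type*} (s : Finset ι) (f : ι → ℂ) : e (∑ i ∈ s, f i) = ∏ i ∈ s, e (f i) := by
  simp only [e, Finset.mul_sum, Complex.exp_sum]

theorem norm_e_ratCast (x : ℚ) : ‖e x‖ = 1 := by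
  rw [e, show (2 * Real.pi * Complex.I * (x : ℂ) : ℂ) = ((2 * Real.pi * x : ℝ) : ℂ) * Complex.I by
    push_cast; ring]
  exact Complex.norm_exp_ofReal_mul_I _

theorem e_nat_mul (n : ℕ) (x : ℂ) : e (n * x) = e x ^ n := by
  rw [e, e, ← Complex.exp_nat_mul]
  ring_nf

/-- A product of absolutely convergent series indexed by `ℤ` is the sum over `ℤⁿ`. -/
theorem hasSum_pi_prod {n : ℕ} (f : Fin n → ℤ → ℂ) (hf : ∀ i, Summable fun k ↦ ‖f i k‖) :
    (Summable fun k : Fin n → ℤ ↦ ‖∏ i, f i (k i)‖) ∧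
      HasSum (fun k : Fin n → ℤ ↦ ∏ i, f i (k i)) (∏ i, ∑' k, f i k) := by
  induction n with
  | zero => exact ⟨Summable.of_finite, by simp⟩
  | succ n ih =>
    obtain ⟨h1, h2⟩ := ih (fun i ↦ f i.succ) fun i ↦ hf _
    let E : ℤ × (Fin n → ℤ) ≃ (Fin (n + 1) → ℤ) := Fin.consEquiv fun _ ↦ ℤ
    have key : ∀ p : ℤ × (Fin n → ℤ), ∏ i, f i (E p i) =
        f 0 p.1 * ∏ i : Fin n, f i.succ (p.2 i) := fun p ↦ by
      simp [E, Fin.consEquiv, Fin.prod_univ_succ]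
    have hn : Summable fun p : ℤ × (Fin n → ℤ) ↦ ‖f 0 p.1 * ∏ i : Fin n, f i.succ (p.2 i)‖ :=
      Summable.mul_norm (f := f 0) (g := fun k : Fin n → ℤ ↦ ∏ i : Fin n, f i.succ (k i)) (hf 0) h1
    have hm := (hf 0).of_norm.hasSum.mul h2 hn.of_norm
    rw [← E.summable_iff, ← E.hasSum_iff, Fin.prod_univ_succ]
    simp only [Function.comp_def, key]
    exact ⟨hn, hm⟩

/-- The summand `e(a t² τ / 2 + t ζ)` of a one-dimensional theta series. -/
def gaussTerm (a : ℝ) (τ ζ t : ℂ) : ℂ := e (a * t ^ 2 / 2 * τ + t * ζ)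

theorem gaussTerm_add_int (a : ℝ) (τ ζ t : ℂ) (k : ℤ) : gaussTerm a τ ζ (t + k) =
    gaussTerm a τ ζ t * jacobiTheta₂_term k (ζ + a * t * τ) (a * τ) := by
  rw [gaussTerm, gaussTerm, e, e, jacobiTheta₂_term, ← Complex.exp_add]
  ring_nf

theorem gaussTerm_int_div {a : ℝ} (ha : 0 < a) (τ ζ : ℂ) (k : ℤ) : gaussTerm a τ ζ (k / a) =
    jacobiTheta₂_term k (ζ / a) (τ / a) := by
  have : (a : ℂ) ≠ 0 := by exact_mod_cast ha.ne'
  rw [gaussTerm, e, jacobiTheta₂_term]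
  congr 1
  field_simp
  ring

theorem summable_gaussTerm_add_int {a : ℝ} (ha : 0 < a) {τ : ℂ} (hτ : 0 < τ.im) (ζ t : ℂ) :
    Summable fun k : ℤ ↦ ‖gaussTerm a τ ζ (t + k)‖ := by
  simp only [gaussTerm_add_int]
  refine (((summable_jacobiTheta₂_term_iff _ _).2 ?_).mul_left _).norm
  rw [Complex.im_ofReal_mul]
  positivity

theorem summable_gaussTerm_int_div {a : ℝ} (ha : 0 < a) {τ : ℂ} (hτ : 0 < τ.im) (ζ : ℂ) :
    Summable fun k : ℤ ↦ ‖gaussTerm a τ ζ (k / a)‖ := by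
  simp only [gaussTerm_int_div ha]
  refine ((summable_jacobiTheta₂_term_iff _ _).2 ?_).norm
  rw [Complex.div_ofReal_im]
  positivity

/-- The inversion formula for one-dimensional theta series with characteristic. -/
theorem tsum_gaussTerm_inversion {a : ℝ} (ha : 0 < a) {τ : ℂ} (hτ : 0 < τ.im) (ζ t : ℂ) :
    (∑' k : ℤ, gaussTerm a (-1 / τ) (ζ / τ) (t + k)) * e (-(ζ ^ 2 / (2 * a * τ))) =
      (-Complex.I * (τ / a)) ^ (1 / 2 : ℂ) * ∑' k : ℤ, e (-(k * t)) * gaussTerm a τ ζ (k / a) := by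
  have ha' : (a : ℂ) ≠ 0 := by exact_mod_cast ha.ne'
  have hτ' : τ ≠ 0 := by rintro rfl; simp at hτ
  have h1 : ∀ k : ℤ, e (-(k * t)) * gaussTerm a τ ζ (k / a) =
      jacobiTheta₂_term k (ζ / a - t) (τ / a) := fun k ↦ by
    rw [gaussTerm_int_div ha, e, jacobiTheta₂_term, jacobiTheta₂_term, ← Complex.exp_add]
    ring_nf
  simp only [h1, gaussTerm_add_int, tsum_mul_left]
  change _ * jacobiTheta₂ _ _ * _ = _ * jacobiTheta₂ _ _
  rw [jacobiTheta₂_functional_equation (ζ / a - t)]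
  have h0 : (-Complex.I * (τ / a)) ^ (1 / 2 : ℂ) ≠ 0 := by
    rw [Complex.cpow_ne_zero_iff]
    left
    simp [ha', hτ']
  have h2 : (ζ / a - t) / (τ / a) = ζ / τ + a * t * (-1 / τ) := by field_simp; ring
  have h3 : -1 / (τ / a) = a * (-1 / τ) := by field_simp
  have h4 : gaussTerm a (-1 / τ) (ζ / τ) t * e (-(ζ ^ 2 / (2 * a * τ))) =
      Complex.exp (-Real.pi * Complex.I * (ζ / a - t) ^ 2 / (τ / a)) := by
    rw [gaussTerm, ← e_add, e]
    congr 1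
    field_simp
    ring
  rw [h2, h3, ← h4, ← mul_assoc, ← mul_assoc, mul_one_div_cancel h0]
  ring

/-- A Fourier series with absolutely summable coefficients that vanishes identically has only zero
coefficients. -/
theorem fourier_coeff_eq_zero {n : ℕ} {c : (Fin n → ℤ) → ℂ} (hc : Summable fun k ↦ ‖c k‖)
    (h : ∀ x : Fin n → ℝ, ∑' k, c k * e (∑ i, (k i : ℂ) * x i) = 0) : c = 0 := by
  have hs : Summable fun k : Fin n → ℤ ↦ c k • UnitAddTorus.mFourier k := by
    refine Summable.of_norm ?_
    simpa [norm_smul, UnitAddTorus.mFourier_norm] using hc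
  have h0 : ∑' k : Fin n → ℤ, c k • UnitAddTorus.mFourier k = 0 := by
    ext y
    obtain ⟨x, rfl⟩ : ∃ x : Fin n → ℝ, y = fun i ↦ (x i : UnitAddCircle) :=
      ⟨fun i ↦ (y i).out, by ext i; simp⟩
    rw [← ContinuousMap.tsum_apply hs]
    refine Eq.trans (tsum_congr fun k ↦ ?_) (h x)
    rw [e_sum]
    simp [UnitAddTorus.mFourier, e, mul_assoc, mul_left_comm]
  have h1 := hs.hasSum
  rw [h0] at h1
  ext k
  let : MeasureTheory.MeasureSpace UnitAddCircle := ⟨AddCircle.haarAddCircle⟩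
  have : MeasureTheory.IsProbabilityMeasure
      (MeasureTheory.volume : MeasureTheory.Measure UnitAddCircle) :=
    inferInstanceAs (MeasureTheory.IsProbabilityMeasure AddCircle.haarAddCircle)
  have h2 : HasSum (fun j ↦ c j • UnitAddTorus.mFourierLp (d := Fin n) 2 j) 0 := by
    simpa only [map_smul, map_zero] using (ContinuousMap.toLp (E := ℂ) 2
      (MeasureTheory.volume : MeasureTheory.Measure (UnitAddTorus (Fin n))) ℂ).hasSum h1
  have h3 := (innerSL ℂ (UnitAddTorus.mFourierLp (d := Fin n) 2 k)).hasSum h2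
  simp only [map_smul, map_zero, innerSL_apply_apply, smul_eq_mul] at h3
  have h4 := orthonormal_iff_ite.1 (UnitAddTorus.orthonormal_mFourier (d := Fin n)) k
  simp only [h4] at h3
  have h5 : HasSum (fun j ↦ c j * if k = j then (1 : ℂ) else 0) (c k) := by
    convert! hasSum_ite_eq k (c k) using 2 with j
    by_cases hj : k = j
    · simp [hj]
    · simp [hj, Ne.symm hj]
  exact h5.unique h3

namespace IntegralLattice

/-! ### The rational and complex spans of a lattice -/

section Span

variable (L : IntegralLattice.{u})

@[simp] theorem toRat_zero : L.toRat 0 = 0 := TensorProduct.tmul_zero _ _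

@[simp] theorem toRat_add (x y : L) : L.toRat (x + y) = L.toRat x + L.toRat y :=
  TensorProduct.tmul_add _ _ _

@[simp] theorem toRat_sub (x y : L) : L.toRat (x - y) = L.toRat x - L.toRat y :=
  TensorProduct.tmul_sub _ _ _

@[simp] theorem toRat_zsmul (m : ℤ) (x : L) : L.toRat (m • x) = (m : ℚ) • L.toRat x := by
  rw [toRat, toRat, TensorProduct.tmul_smul, Int.cast_smul_eq_zsmul]

theorem toRat_sum {ι : Type*} (s : Finset ι) (f : ι → L) :
    L.toRat (∑ i ∈ s, f i) = ∑ i ∈ s, L.toRat (f i) :=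
  TensorProduct.tmul_sum _ _ _

theorem toRat_injective : Function.Injective L.toRat := by
  have h := Module.Flat.rTensor_preserves_injective_linearMap (M := L)
    (Algebra.linearMap ℤ ℚ) (by simpa using! Int.cast_injective)
  intro x y hxy
  refine (TensorProduct.lid ℤ L).symm.injective (h ?_)
  simpa [toRat] using! hxy

@[simp] theorem formQ_toRat (x y : L) : L.formQ (L.toRat x) (L.toRat y) = L.form x y := by
  simp [toRat]

theorem formQ_symm (r s : L.RatSpace) : L.formQ r s = L.formQ s r := by
  induction r using TensorProduct.induction_on with
  | zero => simp
  | add a b ha hb => simp only [map_add, LinearMap.add_apply, ha, hb]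
  | tmul p x =>
    induction s using TensorProduct.induction_on with
    | zero => simp
    | add a b ha hb => simp only [map_add, LinearMap.add_apply, ha, hb]
    | tmul q y => simp [L.symm x y, mul_comm]

theorem exists_smul_eq_toRat (r : L.RatSpace) :
    ∃ (m : ℤ) (x : L), m ≠ 0 ∧ (m : ℚ) • r = L.toRat x := by
  induction r using TensorProduct.induction_on with
  | zero => exact ⟨1, 0, one_ne_zero, by simp⟩
  | tmul q x =>
    refine ⟨q.den, q.num • x, by exact_mod_cast q.den_ne_zero, ?_⟩
    rw [toRat_zsmul, toRat, TensorProduct.smul_tmul', TensorProduct.smul_tmul']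
    simp [Rat.den_mul_eq_num]
  | add a b ha hb =>
    obtain ⟨m, x, hm, hx⟩ := ha
    obtain ⟨k, y, hk, hy⟩ := hb
    refine ⟨m * k, k • x + m • y, mul_ne_zero hm hk, ?_⟩
    rw [toRat_add, toRat_zsmul, toRat_zsmul, ← hx, ← hy]
    push_cast
    rw [smul_add, smul_smul, smul_smul, mul_comm (k : ℚ)]

variable {L} in
theorem IsPosDef.formQ_pos (h : L.IsPosDef) {r : L.RatSpace} (hr : r ≠ 0) : 0 < L.formQ r r := by
  obtain ⟨m, x, hm, hx⟩ := L.exists_smul_eq_toRat r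
  have hm' : (m : ℚ) ≠ 0 := by exact_mod_cast hm
  have hx0 : x ≠ 0 := by
    rintro rfl
    rw [toRat_zero, smul_eq_zero] at hx
    tauto
  have h1 : (0 : ℚ) < L.formQ (L.toRat x) (L.toRat x) := by
    rw [formQ_toRat]
    exact_mod_cast h x hx0
  rw [← hx, map_smul, LinearMap.map_smul, LinearMap.smul_apply, smul_eq_mul, smul_eq_mul,
    ← mul_assoc] at h1
  exact pos_of_mul_pos_right h1 (mul_self_nonneg _)

@[simp] theorem toCplx_tmul (q : ℚ) (x : L) : L.toCplx (q ⊗ₜ x) = (q : ℂ) ⊗ₜ x := rfl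

theorem toCplx_smul (q : ℚ) (r : L.RatSpace) : L.toCplx (q • r) = (q : ℂ) • L.toCplx r := by
  induction r using TensorProduct.induction_on with
  | zero => simp
  | add a b ha hb => simp only [smul_add, map_add, ha, hb]
  | tmul p x => simp [TensorProduct.smul_tmul']

@[simp] theorem toCplx_toRat (x : L) : L.toCplx (L.toRat x) = 1 ⊗ₜ x := by
  rw [toRat, toCplx_tmul, Rat.cast_one]

/-- The class of `β(x, x) / 2` modulo `ℤ` is additive in `x`. -/
theorem e_form_add (x y : L) : e ((L.form (x + y) (x + y) : ℂ) / 2) =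
    e ((L.form x x : ℂ) / 2) * e ((L.form y y : ℂ) / 2) := by
  rw [← e_add]
  refine e_eq_of_sub_int (L.form x y) ?_
  simp only [map_add, LinearMap.add_apply, L.symm y x]
  push_cast
  ring

theorem e_neg_form (x : L) : e (-((L.form x x : ℂ) / 2)) = e ((L.form x x : ℂ) / 2) := by
  refine e_eq_of_sub_int (-L.form x x) ?_
  push_cast
  ring

end Span

section Shadow

variable {L : IntegralLattice.{u}}

theorem mem_shadow_iff (r : L.RatSpace) :
    r ∈ L.shadow ↔ ∀ x : L, e (L.formQ r (L.toRat x)) = e ((L.form x x : ℂ) / 2) := by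
  refine forall_congr' fun x ↦ ?_
  have : e (L.formQ r (L.toRat x)) = e ((L.form x x : ℂ) / 2) ↔
      e (L.formQ r (L.toRat x) - (L.form x x : ℂ) / 2) = 1 := by
    rw [sub_eq_add_neg, e_add, e_neg, mul_inv_eq_one₀ (e_ne_zero _)]
  rw [this, e_eq_one_iff]
  refine exists_congr fun m ↦ ?_
  rw [← @Rat.cast_inj ℂ]
  push_cast
  rfl

theorem e_formQ_toRat (r : L.shadow) (x : L) :
    e (L.formQ r (L.toRat x)) = e ((L.form x x : ℂ) / 2) :=
  (mem_shadow_iff _).1 r.2 x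

theorem add_toRat_mem_shadow {r : L.RatSpace} (hr : r ∈ L.shadow) (x : L) :
    r + L.toRat x ∈ L.shadow := by
  intro y
  obtain ⟨m, hm⟩ := hr y
  refine ⟨m + L.form x y, ?_⟩
  rw [map_add, LinearMap.add_apply, formQ_toRat]
  push_cast
  rw [← hm]
  ring

/-- The translate of an element of the shadow by an element of the lattice. -/
def shadowAdd (r : L.shadow) (x : L) : L.shadow := ⟨r + L.toRat x, add_toRat_mem_shadow r.2 x⟩

@[simp] theorem coe_shadowAdd (r : L.shadow) (x : L) :
    (shadowAdd r x : L.RatSpace) = r + L.toRat x := rfl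

theorem e_neg_formQ_shadowAdd (r s : L.shadow) (x : L) : e (-L.formQ r (shadowAdd s x)) =
    e ((L.form x x : ℂ) / 2) * e (-L.formQ r s) := by
  rw [coe_shadowAdd, map_add, Rat.cast_add, neg_add, e_add, e_neg (L.formQ r (L.toRat x)),
    e_formQ_toRat, ← e_neg, e_neg_form, mul_comm]

theorem W_apply_shadowAdd {l : L.shadow → ℂ} (hl : l ∈ L.W) (r : L.shadow) (x : L) :
    l (shadowAdd r x) = e ((L.form x x : ℂ) / 2) * l r :=
  hl r _ x rfl

variable (L) in
/-- Translation equivalence on the shadow. -/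
def shadowSetoid : Setoid L.shadow where
  r r s := ∃ x : L, s = shadowAdd r x
  iseqv :=
    { refl := fun r ↦ ⟨0, by ext; simp⟩
      symm := by
        rintro r _ ⟨x, rfl⟩
        exact ⟨0 - x, by ext; simp only [coe_shadowAdd, toRat_sub, toRat_zero]; abel⟩
      trans := by
        rintro r _ _ ⟨x, rfl⟩ ⟨y, rfl⟩
        exact ⟨x + y, by ext; simp [add_assoc]⟩ }

variable (L) in
/-- The set of cosets of the lattice in its shadow. -/
abbrev ShadowQuot : Type u := Quotient L.shadowSetoid

variable (L) in
/-- The shadow is the disjoint union of the translates of the lattice. -/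
def shadowEquiv : L.ShadowQuot × L ≃ L.shadow :=
  Equiv.ofBijective (fun p ↦ shadowAdd p.1.out p.2) <| by
    constructor
    · rintro ⟨p, x⟩ ⟨q, y⟩ h
      have h' := congrArg Subtype.val h
      simp only [coe_shadowAdd] at h'
      have hpq : p = q := by
        rw [← Quotient.out_eq p, ← Quotient.out_eq q]
        refine Quotient.sound ⟨x - y, ?_⟩
        ext
        simp only [coe_shadowAdd, toRat_sub]
        rw [← add_sub_assoc, h', add_sub_cancel_right]
      subst hpq
      rw [L.toRat_injective (add_left_cancel h')]
    · intro s
      obtain ⟨x, hx⟩ := Quotient.mk_out (s := L.shadowSetoid) s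
      exact ⟨(⟦s⟧, x), hx.symm⟩

@[simp] theorem shadowEquiv_apply (p : L.ShadowQuot × L) :
    L.shadowEquiv p = shadowAdd p.1.out p.2 := rfl

end Shadow

/-! ### Orthogonal frames -/

variable {L : IntegralLattice.{u}}

variable (L) in
/-- A family of pairwise orthogonal vectors in `2 L` of positive length that spans `ℚ ⊗ L`. -/
structure OrthFrame where
  vec : Fin L.rank → L
  orth : ∀ i j, i ≠ j → L.form (vec i) (vec j) = 0
  pos : ∀ i, 0 < L.form (vec i) (vec i)
  half : Fin L.rank → L
  vec_eq : ∀ i, vec i = (2 : ℤ) • half i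
  expand : ∀ r : L.RatSpace, r =
    ∑ i, (L.formQ r (L.toRat (vec i)) / L.form (vec i) (vec i)) • L.toRat (vec i)

theorem IsPosDef.nonempty_orthFrame (h : L.IsPosDef) : Nonempty L.OrthFrame := by
  have hfin : Module.finrank ℚ L.RatSpace = L.rank := Module.finrank_baseChange
  obtain ⟨b, hb⟩ : ∃ b : Module.Basis (Fin L.rank) ℚ L.RatSpace, L.formQ.IsOrthoᵢ b := by
    rw [← hfin]
    exact LinearMap.BilinForm.exists_orthogonal_basis ⟨fun r s ↦ L.formQ_symm r s⟩
  choose m x hm hx using fun i ↦ L.exists_smul_eq_toRat (b i)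
  have hm' : ∀ i, (m i : ℚ) ≠ 0 := fun i ↦ by exact_mod_cast hm i
  have hv : ∀ i, L.toRat ((2 : ℤ) • x i) = (2 * m i : ℚ) • b i := fun i ↦ by
    rw [toRat_zsmul, ← hx, smul_smul, Int.cast_ofNat]
  have hform : ∀ i j, (L.form ((2 : ℤ) • x i) ((2 : ℤ) • x j) : ℚ) =
      (2 * m i) * (2 * m j) * L.formQ (b i) (b j) := fun i j ↦ by
    rw [← formQ_toRat, hv, hv, map_smul, LinearMap.map_smul, LinearMap.smul_apply, smul_eq_mul,
      smul_eq_mul]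
    ring
  have hpos : ∀ i, 0 < L.formQ (b i) (b i) := fun i ↦ h.formQ_pos (b.ne_zero i)
  refine ⟨⟨fun i ↦ (2 : ℤ) • x i, fun i j hij ↦ ?_, fun i ↦ ?_, x, fun i ↦ rfl, fun r ↦ ?_⟩⟩
  · have := hform i j
    rw [show L.formQ (b i) (b j) = 0 from hb hij, mul_zero] at this
    exact_mod_cast this
  · have : (0 : ℚ) < L.form ((2 : ℤ) • x i) ((2 : ℤ) • x i) := by
      rw [hform]
      have := hpos i
      have := mul_self_pos.2 (mul_ne_zero two_ne_zero (hm' i))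
      positivity
    exact_mod_cast this
  · conv_lhs => rw [← b.sum_repr r]
    refine Finset.sum_congr rfl fun i _ ↦ ?_
    have h1 : L.formQ r (L.toRat ((2 : ℤ) • x i)) =
        b.repr r i * (2 * m i) * L.formQ (b i) (b i) := by
      conv_lhs => rw [← b.sum_repr r]
      rw [hv, map_sum, LinearMap.sum_apply, Finset.sum_eq_single i]
      · simp only [map_smul, LinearMap.smul_apply, smul_eq_mul]
        ring
      · intro j _ hji
        simp only [map_smul, LinearMap.smul_apply, show L.formQ (b j) (b i) = 0 from hb hji,
          smul_zero]
      · simp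
    rw [h1, hform, hv, smul_smul]
    have := (hpos i).ne'
    have := hm' i
    congr 1
    field_simp

end IntegralLattice

namespace IntegralLattice

variable {L : IntegralLattice.{u}}

variable (L) in
/-- The summand `e(τ β(r, r) / 2) e(β(r, z))` of a theta series. -/
def thetaTerm (τ : ℂ) (z : L.CplxSpace) (r : L.RatSpace) : ℂ :=
  e ((L.formQ r r / 2 : ℚ) * τ) * e (L.formC (L.toCplx r) z)

namespace OrthFrame

variable (F : L.OrthFrame)

/-- The squared lengths of the vectors of the frame. -/
def len (i : Fin L.rank) : ℤ := L.form (F.vec i) (F.vec i)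

theorem len_pos (i : Fin L.rank) : 0 < F.len i := F.pos i

theorem len_ne_zero (K : Type*) [DivisionRing K] [CharZero K] (i : Fin L.rank) :
    (F.len i : K) ≠ 0 := by
  have h := (F.len_pos i).ne'
  exact_mod_cast h

/-- The vector with given rational coordinates. -/
def pt (t : Fin L.rank → ℚ) : L.RatSpace := ∑ i, t i • L.toRat (F.vec i)

theorem pt_coord (r : L.RatSpace) :
    F.pt (fun i ↦ L.formQ r (L.toRat (F.vec i)) / F.len i) = r :=
  (F.expand r).symm

theorem formQ_pt (r : L.RatSpace) (t : Fin L.rank → ℚ) :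
    L.formQ r (F.pt t) = ∑ i, t i * L.formQ r (L.toRat (F.vec i)) := by
  simp only [pt, map_sum, map_smul, smul_eq_mul]

theorem formQ_pt_vec (t : Fin L.rank → ℚ) (i : Fin L.rank) :
    L.formQ (F.pt t) (L.toRat (F.vec i)) = t i * F.len i := by
  rw [formQ_symm, formQ_pt, Finset.sum_eq_single i]
  · rw [formQ_toRat, len]
  · intro j _ hj
    rw [formQ_toRat, F.orth i j hj.symm]
    simp
  · simp

theorem formQ_pt_pt (s t : Fin L.rank → ℚ) :
    L.formQ (F.pt s) (F.pt t) = ∑ i, F.len i * s i * t i := by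
  rw [formQ_pt]
  refine Finset.sum_congr rfl fun i _ ↦ ?_
  rw [formQ_pt_vec]
  ring

/-- The coordinates of a complex vector with respect to the dual of the frame. -/
def zeta (z : L.CplxSpace) (i : Fin L.rank) : ℂ := L.formC (1 ⊗ₜ F.vec i) z

theorem formC_toCplx_pt (t : Fin L.rank → ℚ) (z : L.CplxSpace) :
    L.formC (L.toCplx (F.pt t)) z = ∑ i, t i * F.zeta z i := by
  simp only [pt, map_sum, toCplx_smul, toCplx_toRat, LinearMap.sum_apply, map_smul,
    LinearMap.smul_apply, smul_eq_mul, zeta]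

theorem zeta_smul (c : ℂ) (z : L.CplxSpace) (i : Fin L.rank) :
    F.zeta (c • z) i = c * F.zeta z i := by
  simp only [zeta, map_smul, smul_eq_mul]

theorem cplx_expand (z : L.CplxSpace) :
    z = ∑ i, (F.zeta z i / F.len i) • ((1 : ℂ) ⊗ₜ[ℤ] F.vec i : L.CplxSpace) := by
  induction z using TensorProduct.induction_on with
  | zero => simp [zeta]
  | add a b ha hb =>
    conv_lhs => rw [ha, hb]
    rw [← Finset.sum_add_distrib]
    refine Finset.sum_congr rfl fun i _ ↦ ?_
    rw [← add_smul, zeta, zeta, zeta, map_add, add_div]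
  | tmul c x =>
    have h := congrArg L.toCplx (F.expand (L.toRat x))
    simp only [map_sum, toCplx_smul, toCplx_toRat, formQ_toRat] at h
    have h2 : (c ⊗ₜ[ℤ] x : L.CplxSpace) = c • ((1 : ℂ) ⊗ₜ[ℤ] x : L.CplxSpace) := by
      rw [TensorProduct.smul_tmul', smul_eq_mul, mul_one]
    rw [h2]
    conv_lhs => rw [h]
    rw [Finset.smul_sum]
    refine Finset.sum_congr rfl fun i _ ↦ ?_
    rw [smul_smul, zeta_smul, zeta]
    congr 1
    simp [len, L.symm x, mul_div_assoc]

theorem formC_self (z : L.CplxSpace) : L.formC z z = ∑ i, F.zeta z i ^ 2 / F.len i := by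
  conv_lhs => enter [1]; rw [F.cplx_expand z]
  simp only [map_sum, LinearMap.sum_apply, map_smul, LinearMap.smul_apply, smul_eq_mul]
  refine Finset.sum_congr rfl fun i _ ↦ ?_
  change _ * F.zeta z i = _
  ring

theorem exists_zeta_eq (c : Fin L.rank → ℂ) : ∃ z, F.zeta z = c := by
  refine ⟨∑ i, (c i / F.len i) • ((1 : ℂ) ⊗ₜ[ℤ] F.vec i : L.CplxSpace), ?_⟩
  ext j
  rw [zeta, map_sum, Finset.sum_eq_single j]
  · have := F.len_ne_zero ℂ j
    have h : L.formC ((1 : ℂ) ⊗ₜ[ℤ] F.vec j) ((1 : ℂ) ⊗ₜ[ℤ] F.vec j) = F.len j := by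
      simp [len]
    rw [map_smul, smul_eq_mul, h, div_mul_cancel₀ _ this]
  · intro i _ hij
    simp [F.orth j i hij.symm]
  · simp

theorem thetaTerm_pt (τ : ℂ) (z : L.CplxSpace) (t : Fin L.rank → ℚ) :
    L.thetaTerm τ z (F.pt t) = ∏ i, gaussTerm (F.len i) τ (F.zeta z i) (t i) := by
  simp only [gaussTerm]
  rw [thetaTerm, formC_toCplx_pt, formQ_pt_pt, ← e_add, ← e_sum]
  congr 1
  push_cast
  rw [Finset.sum_add_distrib, Finset.sum_div, Finset.sum_mul]
  congr 1
  refine Finset.sum_congr rfl fun i _ ↦ ?_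
  ring

theorem summable_thetaTerm_pt_div {τ : ℂ} (hτ : 0 < τ.im) (z : L.CplxSpace) :
    Summable fun k : Fin L.rank → ℤ ↦ ‖L.thetaTerm τ z (F.pt fun i ↦ (k i : ℚ) / F.len i)‖ := by
  have h := (hasSum_pi_prod (fun (i : Fin L.rank) (k : ℤ) ↦
    gaussTerm (F.len i) τ (F.zeta z i) (k / (F.len i : ℝ)))
    fun i ↦ summable_gaussTerm_int_div (by exact_mod_cast F.len_pos i) hτ _).1
  refine h.congr fun k ↦ ?_
  rw [thetaTerm_pt]
  push_cast
  rfl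

/-- The inversion formula for theta series of lattices with an orthogonal basis. -/
theorem tsum_thetaTerm_inversion {τ : ℂ} (hτ : 0 < τ.im) (z : L.CplxSpace) (t : Fin L.rank → ℚ) :
    (∑' k : Fin L.rank → ℤ, L.thetaTerm (-1 / τ) (τ⁻¹ • z) (F.pt fun i ↦ t i + k i)) *
        e (-(L.formC z z / 2) / τ) =
      (∏ i, (-Complex.I * (τ / F.len i)) ^ (1 / 2 : ℂ)) *
        ∑' k : Fin L.rank → ℤ, e (-L.formQ (F.pt t) (F.pt fun i ↦ (k i : ℚ) / F.len i)) *
          L.thetaTerm τ z (F.pt fun i ↦ (k i : ℚ) / F.len i) := by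
  have hlen : ∀ i, (0 : ℝ) < F.len i := fun i ↦ by exact_mod_cast F.len_pos i
  have hτ' : 0 < (-1 / τ).im := by
    rw [neg_div, Complex.neg_im, one_div, Complex.inv_im, neg_div, neg_neg]
    exact div_pos hτ (Complex.normSq_pos.2 (by rintro rfl; simp at hτ))
  have h1 : ∀ k : Fin L.rank → ℤ, L.thetaTerm (-1 / τ) (τ⁻¹ • z) (F.pt fun i ↦ t i + k i) =
      ∏ i, gaussTerm (F.len i) (-1 / τ) (F.zeta z i / τ) (t i + k i) := fun k ↦ by
    rw [thetaTerm_pt]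
    refine Finset.prod_congr rfl fun i _ ↦ ?_
    rw [zeta_smul]
    push_cast
    rw [inv_mul_eq_div]
  have h2 : ∀ k : Fin L.rank → ℤ, e (-L.formQ (F.pt t) (F.pt fun i ↦ (k i : ℚ) / F.len i)) *
      L.thetaTerm τ z (F.pt fun i ↦ (k i : ℚ) / F.len i) =
      ∏ i, (e (-(k i * t i)) * gaussTerm (F.len i) τ (F.zeta z i) (k i / (F.len i : ℝ))) :=
    fun k ↦ by
      rw [Finset.prod_mul_distrib, ← e_sum, Finset.sum_neg_distrib, thetaTerm_pt, formQ_pt_pt]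
      push_cast
      congr 3
      refine Finset.sum_congr rfl fun i _ ↦ ?_
      have := F.len_ne_zero ℂ i
      field_simp
  have h3 := hasSum_pi_prod
    (fun (i : Fin L.rank) (k : ℤ) ↦ gaussTerm (F.len i) (-1 / τ) (F.zeta z i / τ) (t i + k))
    fun i ↦ summable_gaussTerm_add_int (hlen i) hτ' _ _
  have h4 := hasSum_pi_prod (fun (i : Fin L.rank) (k : ℤ) ↦
    e (-(k * t i)) * gaussTerm (F.len i) τ (F.zeta z i) (k / (F.len i : ℝ))) fun i ↦ by
      refine (summable_gaussTerm_int_div (hlen i) hτ (F.zeta z i)).congr fun k ↦ ?_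
      rw [norm_mul, show (-(k * t i) : ℂ) = ((-(k * t i) : ℚ) : ℂ) by push_cast; rfl,
        norm_e_ratCast, one_mul]
  rw [tsum_congr h1, tsum_congr h2, h3.2.tsum_eq, h4.2.tsum_eq, ← Finset.prod_mul_distrib,
    F.formC_self, neg_div τ (_ / 2), Finset.sum_div, Finset.sum_div, ← Finset.sum_neg_distrib, e_sum,
    ← Finset.prod_mul_distrib]
  refine Finset.prod_congr rfl fun i _ ↦ ?_
  have h5 := tsum_gaussTerm_inversion (hlen i) hτ (F.zeta z i) (t i)
  rw [show F.zeta z i ^ 2 / (F.len i : ℂ) / 2 / τ = F.zeta z i ^ 2 / (2 * (F.len i : ℝ) * τ) by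
    push_cast; field_simp]
  rw [h5]
  push_cast
  rfl

/-- The products of an element of the shadow with the vectors of the frame are integers. -/
theorem exists_int_formQ_vec (r : L.shadow) (i : Fin L.rank) :
    ∃ m : ℤ, L.formQ r (L.toRat (F.vec i)) = m := by
  obtain ⟨m, hm⟩ := r.2 (F.half i)
  refine ⟨2 * m + L.form (F.half i) (F.half i), ?_⟩
  rw [F.vec_eq, toRat_zsmul, map_smul, smul_eq_mul]
  push_cast
  rw [← hm]
  ring

/-- The integral coordinates of an element of the shadow. -/
def intCoord (r : L.shadow) (i : Fin L.rank) : ℤ := (F.exists_int_formQ_vec r i).choose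

theorem formQ_vec_eq_intCoord (r : L.shadow) (i : Fin L.rank) :
    L.formQ r (L.toRat (F.vec i)) = F.intCoord r i := (F.exists_int_formQ_vec r i).choose_spec

theorem pt_intCoord (r : L.shadow) : F.pt (fun i ↦ (F.intCoord r i : ℚ) / F.len i) = r := by
  simp only [← formQ_vec_eq_intCoord]
  exact F.pt_coord r

theorem intCoord_injective : Function.Injective F.intCoord := fun r s h ↦ by
  ext
  rw [← F.pt_intCoord r, h, F.pt_intCoord]

theorem summable_thetaTerm (F : L.OrthFrame) {τ : ℂ} (hτ : 0 < τ.im) (z : L.CplxSpace) :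
    Summable fun r : L.shadow ↦ ‖L.thetaTerm τ z r‖ := by
  refine ((F.summable_thetaTerm_pt_div hτ z).comp_injective F.intCoord_injective).congr fun r ↦ ?_
  simp only [Function.comp_apply]
  rw [pt_intCoord]

/-- The integral combinations of the vectors of the frame. -/
def comb : (Fin L.rank → ℤ) →+ L where
  toFun k := ∑ i, k i • F.vec i
  map_zero' := by simp
  map_add' k l := by simp [add_smul, Finset.sum_add_distrib]

theorem toRat_comb (k : Fin L.rank → ℤ) : L.toRat (F.comb k) = F.pt fun i ↦ (k i : ℚ) := by
  change L.toRat (∑ i, k i • F.vec i) = _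
  rw [toRat_sum]
  simp only [toRat_zsmul]
  rfl

theorem pt_injective : Function.Injective F.pt := fun s t h ↦ by
  ext i
  have := F.formQ_pt_vec s i
  rw [h, F.formQ_pt_vec] at this
  exact (mul_right_cancel₀ (F.len_ne_zero ℚ i) this).symm

theorem comb_injective : Function.Injective F.comb := fun k l h ↦ by
  have := congrArg L.toRat h
  rw [toRat_comb, toRat_comb] at this
  ext i
  exact_mod_cast congrFun (F.pt_injective this) i

theorem e_form_comb (k : Fin L.rank → ℤ) :
    e ((L.form (F.comb k) (F.comb k) : ℂ) / 2) = 1 := by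
  have h : F.comb k = (2 : ℤ) • ∑ i, k i • F.half i := by
    change ∑ i, k i • F.vec i = _
    simp only [F.vec_eq, Finset.smul_sum, smul_comm (2 : ℤ)]
  rw [h, ← e_int (2 * L.form (∑ i, k i • F.half i) (∑ i, k i • F.half i)), map_smul,
    LinearMap.map_smul, LinearMap.smul_apply]
  congr 1
  simp only [smul_eq_mul]
  push_cast
  ring

/-- A vector whose products with the frame are divisible by the squared lengths lies in the span of
the frame. -/
theorem exists_comb_of_dvd {r : L.RatSpace} {m : Fin L.rank → ℤ}
    (hm : ∀ i, L.formQ r (L.toRat (F.vec i)) = m i) (hd : ∀ i, F.len i ∣ m i) :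
    ∃ k, r = L.toRat (F.comb k) := by
  choose k hk using hd
  refine ⟨k, ?_⟩
  rw [toRat_comb, ← F.pt_coord r]
  congr 1
  ext i
  rw [hm, hk]
  have := F.len_ne_zero ℚ i
  push_cast
  field_simp

theorem dvd_sub_of_zmod_eq {i : Fin L.rank} {a b : ℤ}
    (h : (a : ZMod (F.len i).natAbs) = (b : ZMod (F.len i).natAbs)) : F.len i ∣ a - b := by
  rw [← sub_eq_zero, ← Int.cast_sub, ZMod.intCast_zmod_eq_zero_iff_dvd] at h
  exact Int.natAbs_dvd.1 h

instance (i : Fin L.rank) : NeZero (F.len i).natAbs :=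
  ⟨Int.natAbs_ne_zero.2 (F.len_pos i).ne'⟩

theorem finite_shadowQuot (F : L.OrthFrame) : Finite L.ShadowQuot := by
  refine Finite.of_injective
    (fun (q : L.ShadowQuot) (i : Fin L.rank) ↦ (F.intCoord q.out i : ZMod (F.len i).natAbs))
    fun p q h ↦ ?_
  rw [← Quotient.out_eq p, ← Quotient.out_eq q]
  obtain ⟨k, hk⟩ := F.exists_comb_of_dvd
    (r := (q.out : L.RatSpace) - p.out) (m := fun i ↦ F.intCoord q.out i - F.intCoord p.out i)
    (fun i ↦ by
      rw [map_sub, LinearMap.sub_apply, formQ_vec_eq_intCoord, formQ_vec_eq_intCoord, Int.cast_sub])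
    fun i ↦ F.dvd_sub_of_zmod_eq (congrFun h i).symm
  refine Quotient.sound ⟨F.comb k, ?_⟩
  ext
  rw [coe_shadowAdd, ← hk, add_sub_cancel]

instance finite_quotient_range : Finite (L ⧸ F.comb.range) := by
  refine Finite.of_injective
    (fun (q : L ⧸ F.comb.range) (i : Fin L.rank) ↦
      (L.form q.out (F.vec i) : ZMod (F.len i).natAbs)) fun p q h ↦ ?_
  rw [← QuotientAddGroup.out_eq' p, ← QuotientAddGroup.out_eq' q, QuotientAddGroup.eq]
  obtain ⟨k, hk⟩ := F.exists_comb_of_dvd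
    (r := L.toRat (-p.out + q.out)) (m := fun i ↦ L.form q.out (F.vec i) - L.form p.out (F.vec i))
    (fun i ↦ by
      rw [formQ_toRat, map_add, map_neg, LinearMap.add_apply, LinearMap.neg_apply]
      push_cast
      ring)
    fun i ↦ F.dvd_sub_of_zmod_eq (congrFun h i).symm
  exact ⟨k, (L.toRat_injective hk).symm⟩

/-- The lattice is the disjoint union of the cosets of the span of the frame. -/
def cosetEquiv : (L ⧸ F.comb.range) × (Fin L.rank → ℤ) ≃ L :=
  Equiv.ofBijective (fun p ↦ p.1.out + F.comb p.2) <| by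
    constructor
    · rintro ⟨p, k⟩ ⟨q, l⟩ h
      change p.out + F.comb k = q.out + F.comb l at h
      have hpq : p = q := by
        rw [← QuotientAddGroup.out_eq' p, ← QuotientAddGroup.out_eq' q, QuotientAddGroup.eq]
        refine ⟨k - l, ?_⟩
        rw [map_sub, sub_eq_iff_eq_add, neg_add_eq_sub, sub_add_eq_add_sub, ← h, add_sub_cancel_left]
      subst hpq
      rw [F.comb_injective (add_left_cancel h)]
    · intro x
      obtain ⟨⟨_, k, rfl⟩, hk⟩ := QuotientAddGroup.mk_out_eq_add F.comb.range x
      exact ⟨((x : L ⧸ F.comb.range), -k), by simp [hk]⟩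

theorem cosetEquiv_apply (p : (L ⧸ F.comb.range) × (Fin L.rank → ℤ)) :
    F.cosetEquiv p = p.1.out + F.comb p.2 := rfl

end OrthFrame

end IntegralLattice

namespace IntegralLattice

variable {L : IntegralLattice.{u}}

theorem norm_e_form (x : L) : ‖e ((L.form x x : ℂ) / 2)‖ = 1 := by
  rw [← norm_e_ratCast ((L.form x x : ℚ) / 2)]
  push_cast
  rfl

theorem norm_e_neg_formQ (r s : L.RatSpace) : ‖e (-L.formQ r s)‖ = 1 := by
  rw [← norm_e_ratCast (-L.formQ r s)]
  push_cast
  rfl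

namespace OrthFrame

variable (F : L.OrthFrame)

/-- The map `x ↦ e(β(x, x) / 2 - β(x, s))` is a character of the lattice. -/
theorem e_form_mul_e_add (s : L.RatSpace) (x y : L) :
    e ((L.form (x + y) (x + y) : ℂ) / 2) * e (-L.formQ (L.toRat (x + y)) s) =
      (e ((L.form x x : ℂ) / 2) * e (-L.formQ (L.toRat x) s)) *
        (e ((L.form y y : ℂ) / 2) * e (-L.formQ (L.toRat y) s)) := by
  rw [e_form_add, toRat_add, map_add, LinearMap.add_apply, Rat.cast_add, neg_add, e_add]
  ring

theorem e_neg_formQ_comb (k l : Fin L.rank → ℤ) :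
    e (-L.formQ (L.toRat (F.comb l)) (F.pt fun i ↦ (k i : ℚ) / F.len i)) = 1 := by
  rw [toRat_comb, formQ_pt_pt, ← e_int (-∑ i, l i * k i)]
  congr 1
  push_cast
  congr 1
  refine Finset.sum_congr rfl fun i _ ↦ ?_
  have := F.len_ne_zero ℂ i
  field_simp

theorem sum_character [Fintype (L ⧸ F.comb.range)] (k : Fin L.rank → ℤ)
    [Decidable ((F.pt fun i ↦ (k i : ℚ) / F.len i) ∈ L.shadow)] :
    ∑ q : L ⧸ F.comb.range, e ((L.form q.out q.out : ℂ) / 2) *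
        e (-L.formQ (L.toRat q.out) (F.pt fun i ↦ (k i : ℚ) / F.len i)) =
      if (F.pt fun i ↦ (k i : ℚ) / F.len i) ∈ L.shadow then
        (Fintype.card (L ⧸ F.comb.range) : ℂ) else 0 := by
  set s := F.pt fun i ↦ (k i : ℚ) / F.len i with hs
  let g : L → ℂ := fun x ↦ e ((L.form x x : ℂ) / 2) * e (-L.formQ (L.toRat x) s)
  have hg : ∀ x y, g (x + y) = g x * g y := e_form_mul_e_add s
  have hgc : ∀ l, g (F.comb l) = 1 := fun l ↦ by
    simp only [g]
    rw [e_form_comb, hs, e_neg_formQ_comb, one_mul]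
  change ∑ q : L ⧸ F.comb.range, g q.out = _
  have hgs : ∀ x, g x = 1 ↔ e (L.formQ s (L.toRat x)) = e ((L.form x x : ℂ) / 2) := fun x ↦ by
    simp only [g]
    rw [formQ_symm, e_neg, mul_inv_eq_one₀ (e_ne_zero _), eq_comm]
  split_ifs with h
  · rw [mem_shadow_iff] at h
    have h1 : ∀ q : L ⧸ F.comb.range, g q.out = 1 := fun q ↦ (hgs _).2 (h _)
    simp only [h1, Finset.sum_const, Finset.card_univ, nsmul_eq_mul, mul_one]
  · rw [mem_shadow_iff] at h
    push Not at h
    obtain ⟨y, hy⟩ := h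
    have hy1 : g y ≠ 1 := fun h1 ↦ hy ((hgs y).1 h1)
    have hout : ∀ x : L, g (Quotient.out (x : L ⧸ F.comb.range)) = g x := fun x ↦ by
      obtain ⟨⟨_, l, rfl⟩, hl⟩ := QuotientAddGroup.mk_out_eq_add F.comb.range x
      rw [hl, hg, hgc, mul_one]
    have h1 : ∑ q : L ⧸ F.comb.range, g q.out = (∑ q : L ⧸ F.comb.range, g q.out) * g y := by
      conv_lhs => rw [← Equiv.sum_comp (Equiv.addRight (y : L ⧸ F.comb.range))]
      rw [Finset.sum_mul]
      refine Finset.sum_congr rfl fun q _ ↦ ?_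
      rw [← hg]
      have h2 : q + (y : L ⧸ F.comb.range) = ((q.out + y : L) : L ⧸ F.comb.range) := by
        rw [QuotientAddGroup.mk_add, QuotientAddGroup.out_eq']
      change g (q + (y : L ⧸ F.comb.range)).out = _
      rw [h2, hout]
    by_contra h0
    exact hy1 (mul_left_cancel₀ h0 (by rw [← h1, mul_one]))

/-- The inversion formula for a coset of the lattice. -/
theorem tsum_coset_inversion [Fintype (L ⧸ F.comb.range)] {τ : ℂ} (hτ : 0 < τ.im)
    (z : L.CplxSpace) (r : L.shadow) :
    (∑' x : L, e ((L.form x x : ℂ) / 2) * L.thetaTerm (-1 / τ) (τ⁻¹ • z) (shadowAdd r x)) *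
        e (-(L.formC z z / 2) / τ) =
      (∏ i, (-Complex.I * (τ / F.len i)) ^ (1 / 2 : ℂ)) * Fintype.card (L ⧸ F.comb.range) *
        ∑' s : L.shadow, e (-L.formQ r s) * L.thetaTerm τ z s := by
  classical
  have hτ' : 0 < (-1 / τ).im := by
    rw [neg_div, Complex.neg_im, one_div, Complex.inv_im, neg_div, neg_neg]
    exact div_pos hτ (Complex.normSq_pos.2 (by rintro rfl; simp at hτ))
  set K := ∏ i, (-Complex.I * (τ / F.len i)) ^ (1 / 2 : ℂ)
  let s : (Fin L.rank → ℤ) → L.RatSpace := fun k ↦ F.pt fun i ↦ (k i : ℚ) / F.len i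
  have hinj : Function.Injective (shadowAdd r) := fun x y h ↦
    L.toRat_injective (add_left_cancel (congrArg Subtype.val h))
  have hsum : Summable fun x : L ↦
      e ((L.form x x : ℂ) / 2) * L.thetaTerm (-1 / τ) (τ⁻¹ • z) (shadowAdd r x) := by
    refine Summable.of_norm ?_
    simp only [norm_mul, norm_e_form, one_mul]
    exact (F.summable_thetaTerm hτ' (τ⁻¹ • z)).comp_injective hinj
  have hcoset : ∀ q : L ⧸ F.comb.range,
      (∑' k : Fin L.rank → ℤ, e ((L.form (F.cosetEquiv (q, k)) (F.cosetEquiv (q, k)) : ℂ) / 2) *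
        L.thetaTerm (-1 / τ) (τ⁻¹ • z) (shadowAdd r (F.cosetEquiv (q, k)))) *
          e (-(L.formC z z / 2) / τ) =
      K * ∑' k : Fin L.rank → ℤ, (e ((L.form q.out q.out : ℂ) / 2) *
        e (-L.formQ (L.toRat q.out) (s k))) * (e (-L.formQ r (s k)) * L.thetaTerm τ z (s k)) := by
    intro q
    let t : Fin L.rank → ℚ := fun i ↦
      L.formQ (shadowAdd r q.out) (L.toRat (F.vec i)) / F.len i
    have ht : F.pt t = r + L.toRat q.out := F.pt_coord _
    have h1 : ∀ k : Fin L.rank → ℤ,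
        e ((L.form (F.cosetEquiv (q, k)) (F.cosetEquiv (q, k)) : ℂ) / 2) *
        L.thetaTerm (-1 / τ) (τ⁻¹ • z) (shadowAdd r (F.cosetEquiv (q, k))) =
        e ((L.form q.out q.out : ℂ) / 2) *
          L.thetaTerm (-1 / τ) (τ⁻¹ • z) (F.pt fun i ↦ t i + k i) := fun k ↦ by
      have h2 : (F.pt fun i ↦ t i + k i) = F.pt t + L.toRat (F.comb k) := by
        simp only [toRat_comb, pt, add_smul, Finset.sum_add_distrib]
      rw [cosetEquiv_apply, e_form_add, e_form_comb, mul_one, h2, ht, coe_shadowAdd, toRat_add,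
        add_assoc]
    rw [tsum_congr h1, tsum_mul_left, mul_assoc, F.tsum_thetaTerm_inversion hτ, mul_left_comm,
      ← tsum_mul_left]
    congr 1
    refine tsum_congr fun k ↦ ?_
    rw [ht, map_add, LinearMap.add_apply, Rat.cast_add, neg_add, e_add]
    ring
  have hterm : Summable fun k : Fin L.rank → ℤ ↦ ‖L.thetaTerm τ z (s k)‖ :=
    F.summable_thetaTerm_pt_div hτ z
  have hprod := (F.cosetEquiv.summable_iff.2 hsum).tsum_prod
  simp only [Function.comp_apply] at hprod
  rw [← F.cosetEquiv.tsum_eq, hprod, tsum_fintype, Finset.sum_mul]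
  rw [Finset.sum_congr rfl fun q _ ↦ hcoset q, ← Finset.mul_sum, mul_assoc]
  congr 1
  rw [← Summable.tsum_finsetSum]
  · have h3 : ∀ k : Fin L.rank → ℤ, ∑ q : L ⧸ F.comb.range,
        (e ((L.form q.out q.out : ℂ) / 2) * e (-L.formQ (L.toRat q.out) (s k))) *
          (e (-L.formQ r (s k)) * L.thetaTerm τ z (s k)) =
        if s k ∈ L.shadow then (Fintype.card (L ⧸ F.comb.range) : ℂ) *
          (e (-L.formQ r (s k)) * L.thetaTerm τ z (s k)) else 0 := fun k ↦ by
      rw [← Finset.sum_mul, sum_character]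
      split_ifs <;> simp
    rw [tsum_congr h3, ← F.intCoord_injective.tsum_eq, ← tsum_mul_left]
    · refine tsum_congr fun x ↦ ?_
      simp only [s]
      rw [F.pt_intCoord x, if_pos x.2]
    · intro k hk
      rw [Function.mem_support] at hk
      have hmem : s k ∈ L.shadow := by
        by_contra h
        exact hk (if_neg h)
      refine ⟨⟨s k, hmem⟩, ?_⟩
      ext i
      have h4 := F.formQ_pt_vec (fun i ↦ (k i : ℚ) / F.len i) i
      rw [div_mul_cancel₀ _ (F.len_ne_zero ℚ i)] at h4
      exact Int.cast_injective ((F.formQ_vec_eq_intCoord ⟨s k, hmem⟩ i).symm.trans h4)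
  · intro q _
    refine Summable.of_norm (hterm.congr fun k ↦ ?_)
    rw [norm_mul, norm_mul, norm_mul, norm_e_form, norm_e_neg_formQ, norm_e_neg_formQ]
    simp

end OrthFrame

end IntegralLattice

/-! ### Generators of the metaplectic group -/

/-- The holomorphic square root of `-i τ` with positive real part. -/
def sqrtNegI (τ : ℍ) : ℂ := (-Complex.I * τ) ^ (1 / 2 : ℂ)

theorem negI_mul_ne_zero (τ : ℍ) : -Complex.I * (τ : ℂ) ≠ 0 :=
  mul_ne_zero (neg_ne_zero.2 Complex.I_ne_zero) τ.ne_zero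

theorem re_negI_mul (z : ℂ) : (-Complex.I * z).re = z.im := by simp

theorem sqrtNegI_sq (τ : ℍ) : sqrtNegI τ ^ 2 = -Complex.I * τ := by
  rw [sqrtNegI, ← Complex.cpow_nat_mul]
  simp

theorem sqrtNegI_ne_zero (τ : ℍ) : sqrtNegI τ ≠ 0 := fun h ↦
  negI_mul_ne_zero τ (by rw [← sqrtNegI_sq, h]; simp)

theorem mdiff_sqrtNegI : MDiff sqrtNegI := by
  rw [mdifferentiable_iff]
  have h : DifferentiableOn ℂ (fun z : ℂ ↦ (-Complex.I * z) ^ (1 / 2 : ℂ)) {z | 0 < z.im} := by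
    intro z hz
    refine DifferentiableAt.differentiableWithinAt ?_
    refine DifferentiableAt.cpow_const (by fun_prop) (Or.inl ?_)
    rw [re_negI_mul]
    exact hz
  refine h.congr fun z hz ↦ ?_
  simp [sqrtNegI, ofComplex_apply_of_im_pos hz]

theorem e_one_fourth : e (1 / 4) = Complex.I := by
  rw [e, show (2 * Real.pi * Complex.I * (1 / 4) : ℂ) = Real.pi / 2 * Complex.I by ring]
  exact Complex.exp_pi_div_two_mul_I

theorem e_one_eighth_sq : e (1 / 8) ^ 2 = Complex.I := by
  rw [sq, ← e_add, ← e_one_fourth]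
  norm_num

namespace Mp

theorem eq_of_root_eq {α β : Mp} (h : α.mat = β.mat) (τ : ℍ) (hτ : α.root τ = β.root τ) :
    α = β := by
  have hsq : ∀ σ, α.root σ ^ 2 = β.root σ ^ 2 := fun σ ↦ by rw [α.root_sq, β.root_sq, h]
  have := isPreconnected_univ.eq_of_sq_eq (f := α.root) (g := β.root)
    α.holo.continuous.continuousOn β.holo.continuous.continuousOn (fun σ _ ↦ hsq σ)
    (fun {σ} _ ↦ β.root_ne_zero σ) (Set.mem_univ τ) hτ
  ext σ
  · rw [h]
  · exact this (Set.mem_univ σ)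

/-- The lift `(T, 1)` of the translation `T`. -/
def T : Mp where
  mat := ModularGroup.T
  root _ := 1
  holo := mdifferentiable_const
  root_sq τ := by simp [autFactor, ModularGroup.T]

/-- The lift `(S, √τ)` of the inversion `S`. -/
def S : Mp where
  mat := ModularGroup.S
  root τ := e (1 / 8) * sqrtNegI τ
  holo := mdifferentiable_const.mul mdiff_sqrtNegI
  root_sq τ := by
    rw [mul_pow, sqrtNegI_sq, e_one_eighth_sq]
    simp [autFactor, ModularGroup.S, ← mul_assoc]

@[simp] theorem mat_T : T.mat = ModularGroup.T := rfl
@[simp] theorem mat_S : S.mat = ModularGroup.S := rfl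
@[simp] theorem root_T (τ : ℍ) : T.root τ = 1 := rfl
@[simp] theorem root_S (τ : ℍ) : S.root τ = e (1 / 8) * sqrtNegI τ := rfl

theorem coe_T_smul (τ : ℍ) : ((ModularGroup.T • τ : ℍ) : ℂ) = τ + 1 := by
  rw [coe_smul_eq]
  simp [autFactor, ModularGroup.T]

theorem coe_S_smul (τ : ℍ) : ((ModularGroup.S • τ : ℍ) : ℂ) = -1 / τ := by
  rw [coe_smul_eq]
  simp [autFactor, ModularGroup.S]

theorem sqrtNegI_S_smul (τ : ℍ) : sqrtNegI (ModularGroup.S • τ) * sqrtNegI τ = 1 := by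
  have h : -Complex.I * ((ModularGroup.S • τ : ℍ) : ℂ) = (-Complex.I * τ)⁻¹ := by
    rw [coe_S_smul, mul_inv, inv_neg, Complex.inv_I]
    ring
  have harg : (-Complex.I * (τ : ℂ)).arg ≠ Real.pi := by
    rw [Ne, Complex.arg_eq_pi_iff, re_negI_mul]
    exact fun h ↦ lt_asymm h.1 τ.im_pos
  rw [sqrtNegI, h, Complex.inv_cpow _ _ harg]
  exact inv_mul_cancel₀ (sqrtNegI_ne_zero τ)

theorem root_S_sq (τ : ℍ) : (S * S).root τ = Complex.I := by
  rw [root_mul, root_S, root_S, mat_S, mul_mul_mul_comm, sqrtNegI_S_smul, mul_one, ← sq,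
    e_one_eighth_sq]

theorem e_one_sixth : e (1 / 6) = 1 / 2 + Real.sqrt 3 / 2 * Complex.I := by
  rw [e, show (2 * Real.pi * Complex.I * (1 / 6) : ℂ) = ((Real.pi / 3 : ℝ) : ℂ) * Complex.I by
    push_cast; ring, Complex.exp_mul_I, ← Complex.ofReal_cos, ← Complex.ofReal_sin,
    Real.cos_pi_div_three, Real.sin_pi_div_three]
  push_cast
  rfl

/-- The fixed point `e(1/6) - 1` of `S T`. -/
def rho : ℍ := ⟨e (1 / 6) - 1, by
  rw [e_one_sixth]
  simp⟩

theorem coe_rho : (rho : ℂ) = e (1 / 6) - 1 := rfl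

theorem ST_smul_rho : ModularGroup.S • ModularGroup.T • rho = rho := by
  ext
  rw [coe_S_smul, coe_T_smul, coe_rho, sub_add_cancel, div_eq_iff (e_ne_zero _), e_one_sixth]
  have h3 : (Real.sqrt 3 : ℂ) ^ 2 = 3 := by
    exact_mod_cast Real.sq_sqrt (show (0 : ℝ) ≤ 3 by norm_num)
  linear_combination (-(Real.sqrt 3 : ℂ) ^ 2 / 4) * Complex.I_sq + h3 / 4

theorem root_ST_rho : (S * T).root rho = e (1 / 12) := by
  have h1 : -Complex.I * ((ModularGroup.T • rho : ℍ) : ℂ) = e (-(1 / 12)) := by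
    rw [coe_T_smul, coe_rho, sub_add_cancel, ← e_one_fourth, ← one_mul (e (1 / 4)), ← neg_mul,
      show (-1 : ℂ) = e (-(1 / 2)) by
        rw [e, show (2 * Real.pi * Complex.I * (-(1 / 2)) : ℂ) = -(Real.pi * Complex.I) by ring,
          Complex.exp_neg, Complex.exp_pi_mul_I]
        norm_num, ← e_add, ← e_add]
    norm_num
  have h2 : sqrtNegI (ModularGroup.T • rho) = e (-(1 / 24)) := by
    rw [sqrtNegI, h1, e, Complex.cpow_def_of_ne_zero (Complex.exp_ne_zero _), e,
      Complex.log_exp]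
    · congr 1
      ring
    · simp
      nlinarith [Real.pi_pos]
    · simp
      nlinarith [Real.pi_pos]
  rw [root_mul, root_T, mul_one, root_S, mat_T, h2, ← e_add]
  norm_num

theorem ST_cubed : (S * T) * (S * T) * (S * T) = S * S := by
  refine eq_of_root_eq ?_ rho ?_
  · simp only [mat_mul, mat_S, mat_T]
    ext i j
    fin_cases i <;> fin_cases j <;> rfl
  · rw [root_S_sq, root_mul, root_mul, mat_mul, mat_S, mat_T, mul_smul _ _ rho, ST_smul_rho, mul_smul, ST_smul_rho, root_ST_rho,
      ← e_one_fourth, ← e_add, ← e_add]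
    norm_num

theorem closure_S_T : Subgroup.closure {S, T} = (⊤ : Subgroup Mp) := by
  let π : Mp →* SL(2, ℤ) := { toFun := mat, map_one' := rfl, map_mul' := fun _ _ ↦ rfl }
  have hS : S ∈ Subgroup.closure ({S, T} : Set Mp) := Subgroup.subset_closure (by simp)
  have hmap : (Subgroup.closure ({S, T} : Set Mp)).map π = ⊤ := by
    rw [MonoidHom.map_closure, Set.image_pair]
    exact SpecialLinearGroup.SL2Z_generators
  rw [eq_top_iff]
  intro α _
  obtain ⟨β, hβ, hmat⟩ : α.mat ∈ (Subgroup.closure ({S, T} : Set Mp)).map π := by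
    rw [hmap]
    trivial
  change β.mat = α.mat at hmat
  have hsq : α.root UpperHalfPlane.I ^ 2 = β.root UpperHalfPlane.I ^ 2 := by
    rw [α.root_sq, β.root_sq, hmat]
  rcases sq_eq_sq_iff_eq_or_eq_neg.1 hsq with h | h
  · rwa [eq_of_root_eq hmat.symm _ h]
  · have h4mat : ((S * S) * (S * S)).mat = 1 := by
      simp only [mat_mul, mat_S]
      ext i j
      fin_cases i <;> fin_cases j <;> rfl
    have hα : α = β * ((S * S) * (S * S)) := by
      refine eq_of_root_eq (by rw [mat_mul, h4mat, mul_one, hmat]) UpperHalfPlane.I ?_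
      rw [root_mul, h4mat, one_smul, root_mul, root_S_sq, root_S_sq, Complex.I_mul_I, h]
      ring
    rw [hα]
    exact mul_mem hβ (mul_mem (mul_mem hS hS) (mul_mem hS hS))

end Mp

theorem epsilon_T : (epsilon Mp.T : ℂ) = e (1 / 24) := by
  rw [epsilon_apply _ UpperHalfPlane.I, etaQuotient, Mp.mat_T, Mp.root_T, mul_one,
    div_eq_iff (eta_coe_ne_zero _), Mp.coe_T_smul, ModularForm.eta, ModularForm.eta, ← mul_assoc]
  congr 1
  · rw [Function.Periodic.qParam, Function.Periodic.qParam, e, ← Complex.exp_add]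
    push_cast
    congr 1
    ring
  · refine tprod_congr fun n ↦ ?_
    rw [ModularForm.eta_q_eq_pow, ModularForm.eta_q_eq_pow, mul_add, mul_one, Complex.exp_add,
      Complex.exp_two_pi_mul_I, mul_one]

/-! ### The action of the generators on theta functions -/

theorem cpow_half_div {a : ℝ} (ha : 0 < a) (τ : ℍ) :
    (-Complex.I * ((τ : ℂ) / a)) ^ (1 / 2 : ℂ) = (Real.sqrt a⁻¹ : ℂ) * sqrtNegI τ := by
  have ha' : 0 < a⁻¹ := inv_pos.2 ha
  have h0 : ((a⁻¹ : ℝ) : ℂ) ≠ 0 := by exact_mod_cast ha'.ne'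
  rw [show -Complex.I * ((τ : ℂ) / a) = ((a⁻¹ : ℝ) : ℂ) * (-Complex.I * τ) by push_cast; ring,
    Complex.cpow_def_of_ne_zero (mul_ne_zero h0 (negI_mul_ne_zero τ)),
    Complex.log_ofReal_mul ha' (negI_mul_ne_zero τ), add_mul, Complex.exp_add, sqrtNegI,
    Complex.cpow_def_of_ne_zero (negI_mul_ne_zero τ), Real.sqrt_eq_rpow, Complex.ofReal_cpow ha'.le,
    Complex.cpow_def_of_ne_zero h0, Complex.ofReal_log ha'.le]
  push_cast
  rfl

namespace IntegralLattice

variable {L : IntegralLattice.{u}}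

theorem theta_apply (l : L.shadow → ℂ) (τ : ℍ) (z : L.CplxSpace) :
    L.theta l τ z = ∑' r : L.shadow, l r * L.thetaTerm τ z r := by
  simp only [theta, thetaTerm, mul_assoc]

/-- The operator of multiplication by `e(β(r, r) / 2)`. -/
def opT (l : L.W) : L.W where
  val r := e ((L.formQ r r / 2 : ℚ)) * l.1 r
  property r s x h := by
    obtain rfl : s = shadowAdd r x := Subtype.ext h
    change _ * l.1 (shadowAdd r x) = _ * (_ * l.1 r)
    rw [W_apply_shadowAdd l.2, mul_left_comm]
    congr 2
    obtain ⟨m, hm⟩ := r.2 x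
    refine e_eq_of_sub_int (m + L.form x x) ?_
    rw [← Rat.cast_sub, ← Rat.cast_intCast, Rat.cast_inj]
    simp only [coe_shadowAdd, map_add, LinearMap.add_apply, formQ_toRat,
      L.formQ_symm (L.toRat x)]
    push_cast
    rw [← hm]
    ring

theorem opT_apply (l : L.W) (r : L.shadow) :
    (opT l).1 r = e ((L.formQ r r / 2 : ℚ)) * l.1 r := rfl

/-- The unnormalized discrete Fourier transform. -/
def opD (l : L.W) : L.W where
  val s := ∑' q : L.ShadowQuot, e (-L.formQ q.out s) * l.1 q.out
  property r s x h := by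
    obtain rfl : s = shadowAdd r x := Subtype.ext h
    simp only [e_neg_formQ_shadowAdd, mul_assoc, tsum_mul_left]

theorem opD_apply (l : L.W) (s : L.shadow) :
    (opD l).1 s = ∑' q : L.ShadowQuot, e (-L.formQ q.out s) * l.1 q.out := rfl

theorem slash_T_theta (l : L.W) : L.slash (L.theta l.1) Mp.T = L.theta (opT l).1 := by
  ext τ z
  have h : autFactor ModularGroup.T τ = 1 := by simp [autFactor, ModularGroup.T]
  have h10 : (ModularGroup.T 1 0 : ℂ) = 0 := by simp [ModularGroup.T]
  rw [slash, Mp.mat_T, h, Mp.root_T, h10, theta_apply, theta_apply]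
  simp only [inv_one, one_smul, neg_zero, zero_mul, zero_div, e_zero, one_pow, mul_one]
  refine tsum_congr fun r ↦ ?_
  rw [thetaTerm, thetaTerm, Mp.coe_T_smul, mul_add, e_add, mul_one, opT_apply]
  ring

theorem OrthFrame.exists_norm_W_le (F : L.OrthFrame) (l : L.W) : ∃ C, ∀ r, ‖l.1 r‖ ≤ C := by
  have := F.finite_shadowQuot
  obtain ⟨C, hC⟩ := Finite.bddAbove_range fun q : L.ShadowQuot ↦ ‖l.1 q.out‖
  refine ⟨C, fun r ↦ ?_⟩
  obtain ⟨p, rfl⟩ := L.shadowEquiv.surjective r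
  rw [shadowEquiv_apply, W_apply_shadowAdd l.2, norm_mul, norm_e_form, one_mul]
  exact hC ⟨p.1, rfl⟩

theorem OrthFrame.summable_norm_mul_thetaTerm (F : L.OrthFrame) (l : L.W) {τ : ℂ} (hτ : 0 < τ.im)
    (z : L.CplxSpace) : Summable fun r : L.shadow ↦ ‖l.1 r * L.thetaTerm τ z r‖ := by
  obtain ⟨C, hC⟩ := F.exists_norm_W_le l
  refine Summable.of_nonneg_of_le (fun r ↦ norm_nonneg _) (fun r ↦ ?_)
    ((F.summable_thetaTerm hτ z).mul_left C)
  rw [norm_mul]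
  exact mul_le_mul_of_nonneg_right (hC r) (norm_nonneg _)

theorem OrthFrame.slash_S_theta (F : L.OrthFrame) : ∃ c : ℝ, 0 < c ∧ ∀ l : L.W,
    L.slash (L.theta l.1) Mp.S = ((c : ℂ) * e (-(L.rank / 8))) • L.theta (opD l).1 := by
  have := F.finite_shadowQuot
  have := Fintype.ofFinite L.ShadowQuot
  have := Fintype.ofFinite (L ⧸ F.comb.range)
  have hlen : ∀ i, (0 : ℝ) < F.len i := fun i ↦ by exact_mod_cast F.len_pos i
  refine ⟨(∏ i, Real.sqrt (F.len i : ℝ)⁻¹) * Fintype.card (L ⧸ F.comb.range), ?_, fun l ↦ ?_⟩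
  · refine mul_pos (Finset.prod_pos fun i _ ↦ Real.sqrt_pos.2 (inv_pos.2 (hlen i))) ?_
    exact_mod_cast Fintype.card_pos
  ext τ z
  have hτ := τ.im_pos
  have hS : autFactor ModularGroup.S τ = τ := by simp [autFactor, ModularGroup.S]
  have h10 : (ModularGroup.S 1 0 : ℂ) = 1 := by simp [ModularGroup.S]
  have hSτ : 0 < (-1 / (τ : ℂ)).im := by
    rw [← Mp.coe_S_smul]
    exact (ModularGroup.S • τ).im_pos
  have hprod : ∏ i, (-Complex.I * ((τ : ℂ) / F.len i)) ^ (1 / 2 : ℂ) =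
      (∏ i, (Real.sqrt (F.len i : ℝ)⁻¹ : ℂ)) * sqrtNegI τ ^ L.rank := by
    rw [Finset.prod_congr rfl fun i _ ↦ by
      rw [← Complex.ofReal_intCast, cpow_half_div (hlen i)], Finset.prod_mul_distrib]
    simp
  have hsum := (F.summable_norm_mul_thetaTerm l hSτ ((τ : ℂ)⁻¹ • z)).of_norm
  have hsplit := (L.shadowEquiv.summable_iff.2 hsum).tsum_prod
  simp only [Function.comp_apply, shadowEquiv_apply, W_apply_shadowAdd l.2] at hsplit
  have hcoset : ∀ q : L.ShadowQuot,
      (∑' x : L, e ((L.form x x : ℂ) / 2) * l.1 q.out *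
        L.thetaTerm (-1 / τ) ((τ : ℂ)⁻¹ • z) (shadowAdd q.out x)) * e (-(L.formC z z / 2) / τ) =
      (∏ i, (-Complex.I * ((τ : ℂ) / F.len i)) ^ (1 / 2 : ℂ)) *
        Fintype.card (L ⧸ F.comb.range) *
        ∑' s : L.shadow, (e (-L.formQ q.out s) * l.1 q.out) * L.thetaTerm τ z s := fun q ↦ by
    simp only [mul_comm _ (l.1 q.out), mul_assoc (l.1 q.out), tsum_mul_left]
    rw [F.tsum_coset_inversion hτ]
    ring
  have hD : L.theta (opD l).1 τ z = ∑ q : L.ShadowQuot,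
      ∑' s : L.shadow, (e (-L.formQ q.out s) * l.1 q.out) * L.thetaTerm τ z s := by
    rw [← Summable.tsum_finsetSum]
    · rw [theta_apply]
      refine tsum_congr fun s ↦ ?_
      rw [opD_apply, tsum_fintype, Finset.sum_mul]
    · intro q _
      refine Summable.of_norm (((F.summable_thetaTerm hτ z).mul_left ‖l.1 q.out‖).congr fun s ↦ ?_)
      rw [norm_mul, norm_mul, norm_e_neg_formQ, one_mul]
  rw [Pi.smul_apply, Pi.smul_apply, smul_eq_mul, hD, slash, Mp.mat_S, hS, h10, theta_apply,
    Mp.coe_S_smul, ← L.shadowEquiv.tsum_eq]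
  simp only [shadowEquiv_apply, W_apply_shadowAdd l.2]
  rw [hsplit, tsum_fintype, Finset.sum_mul]
  rw [neg_mul, one_mul, Finset.sum_congr rfl fun q _ ↦ hcoset q, ← Finset.mul_sum, hprod,
    Mp.root_S]
  have h8 : e (-(L.rank / 8)) = (e (1 / 8))⁻¹ ^ L.rank := by
    rw [← e_neg, ← e_nat_mul]
    congr 1
    ring
  have := sqrtNegI_ne_zero τ
  rw [h8, mul_inv, mul_pow]
  have h9 : sqrtNegI τ ^ L.rank * (sqrtNegI τ)⁻¹ ^ L.rank = 1 := by
    rw [← mul_pow, mul_inv_cancel₀ this, one_pow]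
  push_cast
  linear_combination (∏ i, (Real.sqrt (F.len i : ℝ)⁻¹ : ℂ)) * Fintype.card (L ⧸ F.comb.range) *
    (∑ q : L.ShadowQuot, ∑' s : L.shadow,
      (e (-L.formQ q.out s) * l.1 q.out) * L.thetaTerm τ z s) * (e (1 / 8))⁻¹ ^ L.rank * h9

/-- The theta function attached to a nonzero element of `W` is nonzero. -/
theorem OrthFrame.eq_zero_of_theta_eq_zero (F : L.OrthFrame) (l : L.W) (h : L.theta l.1 = 0) :
    l = 0 := by
  let c : (Fin L.rank → ℤ) → ℂ := Function.extend F.intCoord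
    (fun r : L.shadow ↦ l.1 r * L.thetaTerm UpperHalfPlane.I 0 r) 0
  have hext : ∀ r, c (F.intCoord r) = l.1 r * L.thetaTerm UpperHalfPlane.I 0 r := fun r ↦
    F.intCoord_injective.extend_apply _ _ r
  have hzero : ∀ k, k ∉ Set.range F.intCoord → c k = 0 := fun k hk ↦
    Function.extend_apply' _ _ _ hk
  have hc : Summable fun k ↦ ‖c k‖ := by
    rw [← F.intCoord_injective.summable_iff]
    · refine (F.summable_norm_mul_thetaTerm l UpperHalfPlane.I.im_pos 0).congr fun r ↦ ?_
      rw [Function.comp_apply, hext]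
    · intro k hk
      rw [hzero k hk, norm_zero]
  have h0 : c = 0 := by
    refine fourier_coeff_eq_zero hc fun x ↦ ?_
    obtain ⟨z, hz⟩ := F.exists_zeta_eq fun i ↦ (x i : ℂ) * F.len i
    have h1 := congrFun (congrFun h UpperHalfPlane.I) z
    rw [theta_apply] at h1
    rw [← F.intCoord_injective.tsum_eq]
    · refine Eq.trans (tsum_congr fun r ↦ ?_) h1
      have h2 : L.formC (L.toCplx r) z = ∑ i, (F.intCoord r i : ℂ) * x i := by
        conv_lhs => rw [← F.pt_intCoord r, F.formC_toCplx_pt, hz]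
        refine Finset.sum_congr rfl fun i _ ↦ ?_
        have := F.len_ne_zero ℂ i
        push_cast
        field_simp
      rw [hext, thetaTerm, thetaTerm, map_zero, e_zero, mul_one, h2, mul_assoc]
    · intro k hk
      by_contra hk'
      exact hk (by simp only [hzero k hk', zero_mul])
  ext r
  have h1 := hext r
  rw [h0, Pi.zero_apply, eq_comm, mul_eq_zero] at h1
  exact h1.resolve_right (mul_ne_zero (e_ne_zero _) (e_ne_zero _))

/-- The linear isomorphism between `W` and the space of theta functions. -/
theorem OrthFrame.exists_thetaEquiv (F : L.OrthFrame) :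
    ∃ φ : L.W ≃ₗ[ℂ] L.Theta, ∀ l, (φ l : ℍ → L.CplxSpace → ℂ) = L.theta l.1 := by
  let f : L.W →ₗ[ℂ] (ℍ → L.CplxSpace → ℂ) :=
    { toFun := fun l ↦ L.theta l.1
      map_add' := fun l m ↦ by
        ext τ z
        simp only [Pi.add_apply, theta_apply, Submodule.coe_add, add_mul]
        exact ((F.summable_norm_mul_thetaTerm l τ.im_pos z).of_norm).tsum_add
          (F.summable_norm_mul_thetaTerm m τ.im_pos z).of_norm
      map_smul' := fun a l ↦ by
        ext τ z
        simp only [Pi.smul_apply, theta_apply, Submodule.coe_smul, smul_eq_mul, mul_assoc,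
          tsum_mul_left, RingHom.id_apply] }
  have hrange : LinearMap.range f = L.Theta := by
    rw [Theta, ← Submodule.span_eq (LinearMap.range f)]
    congr 1
    ext g
    constructor
    · rintro ⟨l, rfl⟩
      exact ⟨l.1, l.2, rfl⟩
    · rintro ⟨l, hl, rfl⟩
      exact ⟨⟨l, hl⟩, rfl⟩
  have hinj : Function.Injective f :=
    (injective_iff_map_eq_zero f).2 fun l h ↦ F.eq_zero_of_theta_eq_zero l h
  exact ⟨(LinearEquiv.ofInjective f hinj).trans (LinearEquiv.ofEq _ _ hrange), fun l ↦ rfl⟩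

end IntegralLattice

namespace IntegralLattice

/-! ### Maps between shadows -/

/-- A map between the shadows of two lattices that is compatible with translations, induces a
bijection of the cosets, and changes the values of the form by a constant. -/
structure ShadowMap (L : IntegralLattice.{u}) (M : IntegralLattice.{v}) where
  map : L.shadow → M.shadow
  base : L → M
  const : ℚ
  form_base : ∀ x, M.form (base x) (base x) = L.form x x
  map_add : ∀ r x, map (shadowAdd r x) = shadowAdd (map r) (base x)
  formQ_map : ∀ r s, M.formQ (map r) (map s) = L.formQ r s + const
  surj : ∀ s, ∃ r y, s = shadowAdd (map r) y
  inj : ∀ r s y, map s = shadowAdd (map r) y → ∃ x, s = shadowAdd r x ∧ base x = y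

/-- A linear isomorphism between the spaces `W` that commutes with the operators up to the
constants attached to `k`. -/
def Compat {L : IntegralLattice.{u}} {M : IntegralLattice.{v}} (Ψ : L.W ≃ₗ[ℂ] M.W) (k : ℚ) :
    Prop :=
  (∀ l, Ψ (opT l) = e ((k / 2 : ℚ)) • opT (Ψ l)) ∧ ∀ l, Ψ (opD l) = e (-k) • opD (Ψ l)

theorem Compat.symm {L : IntegralLattice.{u}} {M : IntegralLattice.{v}} {Ψ : L.W ≃ₗ[ℂ] M.W}
    {k : ℚ} (h : Compat Ψ k) : Compat Ψ.symm (-k) := by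
  constructor
  · intro l
    have h1 := h.1 (Ψ.symm l)
    rw [LinearEquiv.apply_symm_apply] at h1
    rw [LinearEquiv.symm_apply_eq, map_smul, h1, smul_smul, ← e_add, ← Rat.cast_add, neg_div,
      neg_add_cancel, Rat.cast_zero, e_zero, one_smul]
  · intro l
    have h1 := h.2 (Ψ.symm l)
    rw [LinearEquiv.apply_symm_apply] at h1
    rw [LinearEquiv.symm_apply_eq, map_smul, h1, smul_smul, ← e_add, Rat.cast_neg, neg_neg,
      add_neg_cancel, e_zero, one_smul]

theorem Compat.trans {L : IntegralLattice.{u}} {M : IntegralLattice.{v}} {N : IntegralLattice.{w}}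
    {Ψ : L.W ≃ₗ[ℂ] M.W} {Ψ' : M.W ≃ₗ[ℂ] N.W} {k k' : ℚ} (h : Compat Ψ k) (h' : Compat Ψ' k') :
    Compat (Ψ.trans Ψ') (k + k') := by
  constructor
  · intro l
    rw [LinearEquiv.trans_apply, h.1, map_smul, h'.1, smul_smul, ← e_add, ← Rat.cast_add, ← add_div]
    rfl
  · intro l
    rw [LinearEquiv.trans_apply, h.2, map_smul, h'.2, smul_smul, ← e_add, ← neg_add, ← Rat.cast_add]
    rfl

section

variable {L : IntegralLattice.{u}} {M : IntegralLattice.{v}}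

theorem e_form_mul_self (x : L) : e ((L.form x x : ℂ) / 2) * e ((L.form x x : ℂ) / 2) = 1 := by
  conv_lhs => enter [1]; rw [← e_neg_form]
  rw [← e_add, neg_add_cancel, e_zero]

namespace ShadowMap

variable (j : ShadowMap L M)

/-- Restriction along a map between shadows. -/
def restrict : M.W →ₗ[ℂ] L.W where
  toFun l := ⟨fun r ↦ l.1 (j.map r), fun r s x h ↦ by
    obtain rfl : s = shadowAdd r x := Subtype.ext h
    change l.1 (j.map (shadowAdd r x)) = _ * l.1 (j.map r)
    rw [j.map_add, W_apply_shadowAdd l.2, j.form_base]⟩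
  map_add' _ _ := rfl
  map_smul' _ _ := rfl

theorem restrict_apply (l : M.W) (r : L.shadow) : (j.restrict l).1 r = l.1 (j.map r) := rfl

theorem restrict_injective : Function.Injective j.restrict := by
  rw [injective_iff_map_eq_zero]
  intro l h
  ext s
  obtain ⟨r, y, rfl⟩ := j.surj s
  rw [W_apply_shadowAdd l.2, ← j.restrict_apply, h]
  simp

theorem extend_wellDefined (l : L.W) {r r' : L.shadow} {y y' : M}
    (h : shadowAdd (j.map r) y = shadowAdd (j.map r') y') :
    e ((M.form y y : ℂ) / 2) * l.1 r = e ((M.form y' y' : ℂ) / 2) * l.1 r' := by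
  have h' := congrArg Subtype.val h
  simp only [coe_shadowAdd] at h'
  obtain ⟨x, rfl, hx⟩ := j.inj r r' (y - y') <| by
    ext
    rw [coe_shadowAdd, toRat_sub, ← add_sub_assoc, h', add_sub_cancel_right]
  rw [W_apply_shadowAdd l.2, ← j.form_base, hx, ← mul_assoc, ← e_form_add, add_sub_cancel]

theorem restrict_surjective : Function.Surjective j.restrict := by
  intro l
  choose r y hry using j.surj
  refine ⟨⟨fun s ↦ e ((M.form (y s) (y s) : ℂ) / 2) * l.1 (r s), fun s s' x h ↦ ?_⟩, ?_⟩
  · obtain rfl : s' = shadowAdd s x := Subtype.ext h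
    rw [← mul_assoc, ← e_form_add]
    refine j.extend_wellDefined l ?_
    rw [← hry]
    ext
    conv_lhs => rw [hry s]
    simp only [coe_shadowAdd, toRat_add]
    abel
  · ext s
    have h := j.extend_wellDefined l (r := r (j.map s)) (r' := s) (y := y (j.map s)) (y' := 0) <| by
      rw [← hry]
      ext
      simp
    rw [restrict_apply]
    simpa [e_zero] using h

/-- Restriction along a map between shadows as a linear isomorphism. -/
def equiv : M.W ≃ₗ[ℂ] L.W :=
  LinearEquiv.ofBijective j.restrict ⟨j.restrict_injective, j.restrict_surjective⟩

theorem equiv_apply (l : M.W) (r : L.shadow) : (j.equiv l).1 r = l.1 (j.map r) := rfl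

/-- The bijection between the cosets. -/
def quotEquiv : L.ShadowQuot ≃ M.ShadowQuot :=
  Equiv.ofBijective (fun q ↦ Quotient.mk M.shadowSetoid (j.map q.out)) <| by
    constructor
    · intro p q h
      obtain ⟨y, hy⟩ := Quotient.exact h
      obtain ⟨x, hx, -⟩ := j.inj _ _ _ hy
      rw [← Quotient.out_eq p, ← Quotient.out_eq q]
      exact Quotient.sound ⟨x, hx⟩
    · intro q
      obtain ⟨r, y, hr⟩ := j.surj q.out
      refine ⟨Quotient.mk L.shadowSetoid r, ?_⟩
      obtain ⟨x, hx⟩ := L.shadowSetoid.symm (Quotient.mk_out (s := L.shadowSetoid) r)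
      rw [← Quotient.out_eq q]
      refine Quotient.sound ⟨y - j.base x, ?_⟩
      rw [hr, hx, j.map_add]
      ext
      simp

theorem tsum_quot {f : M.shadow → ℂ} (hf : ∀ s y, f (shadowAdd s y) = f s) :
    ∑' q : M.ShadowQuot, f q.out = ∑' q : L.ShadowQuot, f (j.map q.out) := by
  rw [← j.quotEquiv.tsum_eq]
  refine tsum_congr fun q ↦ ?_
  obtain ⟨y, hy⟩ := M.shadowSetoid.symm (Quotient.mk_out (s := M.shadowSetoid) (j.map q.out))
  change f (Quotient.out (Quotient.mk M.shadowSetoid (j.map q.out))) = _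
  rw [hy, hf]

theorem compat_equiv : Compat j.equiv j.const := by
  constructor
  · intro l
    ext r
    change (opT l).1 (j.map r) = e _ * (opT (j.equiv l)).1 r
    rw [opT_apply, opT_apply, equiv_apply, ← mul_assoc, ← e_add, ← Rat.cast_add, j.formQ_map]
    congr 3
    ring
  · intro l
    ext s
    change (opD l).1 (j.map s) = e _ * (opD (j.equiv l)).1 s
    rw [opD_apply, opD_apply, ← tsum_mul_left,
      j.tsum_quot (f := fun r ↦ e (-M.formQ r (j.map s)) * l.1 r)]
    · refine tsum_congr fun q ↦ ?_
      rw [j.formQ_map, equiv_apply, Rat.cast_add, neg_add, e_add]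
      ring
    · intro r y
      rw [formQ_symm, e_neg_formQ_shadowAdd, W_apply_shadowAdd l.2, formQ_symm, mul_mul_mul_comm,
        e_form_mul_self, one_mul]

end ShadowMap

/-! ### Linear maps and base change -/

theorem formQ_baseChange {f : L →ₗ[ℤ] M} (hf : ∀ x y, M.form (f x) (f y) = L.form x y)
    (r s : L.RatSpace) : M.formQ (f.baseChange ℚ r) (f.baseChange ℚ s) = L.formQ r s := by
  induction r using TensorProduct.induction_on with
  | zero => simp
  | add a b ha hb => simp only [map_add, LinearMap.add_apply, ha, hb]
  | tmul p x =>
    induction s using TensorProduct.induction_on with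
    | zero => simp
    | add a b ha hb => simp only [map_add, ha, hb]
    | tmul q y => simp [hf]

theorem formQ_baseChange_eq_zero {N : IntegralLattice.{w}} {f : L →ₗ[ℤ] N} {g : M →ₗ[ℤ] N}
    (hfg : ∀ x y, N.form (f x) (g y) = 0) (r : L.RatSpace) (s : M.RatSpace) :
    N.formQ (f.baseChange ℚ r) (g.baseChange ℚ s) = 0 := by
  induction r using TensorProduct.induction_on with
  | zero => simp
  | add a b ha hb => simp only [map_add, LinearMap.add_apply, ha, hb, add_zero]
  | tmul p x =>
    induction s using TensorProduct.induction_on with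
    | zero => simp
    | add a b ha hb => simp only [map_add, ha, hb, add_zero]
    | tmul q y => simp [hfg]

theorem toRat_map (f : L →ₗ[ℤ] M) (x : L) : M.toRat (f x) = f.baseChange ℚ (L.toRat x) := rfl

theorem baseChange_comp_apply {N : IntegralLattice.{w}} (f : L →ₗ[ℤ] M) (g : M →ₗ[ℤ] N)
    (r : L.RatSpace) : g.baseChange ℚ (f.baseChange ℚ r) = (g ∘ₗ f).baseChange ℚ r := by
  rw [LinearMap.baseChange_comp]
  rfl

/-- The map between shadows induced by an isometry. -/
def ShadowMap.ofIsometry (f : L ≃ₗ[ℤ] M) (hf : ∀ x y, M.form (f x) (f y) = L.form x y) :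
    ShadowMap L M where
  map r := ⟨f.toLinearMap.baseChange ℚ r, fun y ↦ by
    obtain ⟨m, hm⟩ := r.2 (f.symm y)
    refine ⟨m, ?_⟩
    have h1 : M.toRat y = f.toLinearMap.baseChange ℚ (L.toRat (f.symm y)) := by
      rw [← toRat_map]
      simp
    rw [h1, formQ_baseChange hf, ← hm, ← hf (f.symm y), f.apply_symm_apply]⟩
  base := f
  const := 0
  form_base x := hf x x
  map_add r x := by
    ext
    simp only [coe_shadowAdd, _root_.map_add]
    rfl
  formQ_map r s := by rw [add_zero, formQ_baseChange hf]
  surj s := by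
    have h2 : f.toLinearMap.baseChange ℚ (f.symm.toLinearMap.baseChange ℚ s) = s := by
      rw [baseChange_comp_apply]
      simp
    refine ⟨⟨f.symm.toLinearMap.baseChange ℚ s, fun x ↦ ?_⟩, 0, ?_⟩
    · obtain ⟨m, hm⟩ := s.2 (f x)
      refine ⟨m, ?_⟩
      rw [← hm, hf, ← formQ_baseChange hf, h2]
      rfl
    · ext
      simp [h2]
  inj r s y h := by
    refine ⟨f.symm y, ?_, by simp⟩
    ext
    have h1 := congrArg (fun t : M.shadow ↦ f.symm.toLinearMap.baseChange ℚ (t : M.RatSpace)) h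
    simp only [coe_shadowAdd, _root_.map_add, baseChange_comp_apply] at h1
    rw [← toRat_map] at h1
    simpa using h1

end

/-! ### Unimodular summands -/

section OrthSum

variable (L : IntegralLattice.{u}) (U : IntegralLattice.{v})

/-- The inclusion of the first summand. -/
def inl : L →ₗ[ℤ] (L.orthSum U) := LinearMap.inl ℤ L U

/-- The inclusion of the second summand. -/
def inr : U →ₗ[ℤ] (L.orthSum U) := LinearMap.inr ℤ L U

/-- The projection onto the first summand. -/
def fst : (L.orthSum U) →ₗ[ℤ] L := LinearMap.fst ℤ L U

/-- The projection onto the second summand. -/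
def snd : (L.orthSum U) →ₗ[ℤ] U := LinearMap.snd ℤ L U

theorem inl_fst_add_inr_snd (x : L.orthSum U) : L.inl U (L.fst U x) + L.inr U (L.snd U x) = x :=
  Prod.ext (add_zero _) (zero_add _)

theorem fst_inl (x : L) : L.fst U (L.inl U x) = x := rfl
theorem snd_inr (x : U) : L.snd U (L.inr U x) = x := rfl
theorem fst_inr (x : U) : L.fst U (L.inr U x) = 0 := rfl
theorem snd_inl (x : L) : L.snd U (L.inl U x) = 0 := rfl

theorem form_inl_inl (x y : L) : (L.orthSum U).form (L.inl U x) (L.inl U y) = L.form x y := by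
  refine (orthSum_form L U _ _).trans ?_
  change L.form x y + U.form 0 0 = _
  simp

theorem form_inr_inr (x y : U) : (L.orthSum U).form (L.inr U x) (L.inr U y) = U.form x y := by
  refine (orthSum_form L U _ _).trans ?_
  change L.form 0 0 + U.form x y = _
  simp

theorem form_inl_inr (x : L) (y : U) : (L.orthSum U).form (L.inl U x) (L.inr U y) = 0 := by
  refine (orthSum_form L U _ _).trans ?_
  change L.form x 0 + U.form 0 y = _
  simp

theorem form_inr_inl (x : U) (y : L) : (L.orthSum U).form (L.inr U x) (L.inl U y) = 0 := by
  rw [(L.orthSum U).symm, form_inl_inr]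

/-- The vector of `ℚ ⊗ (L ⊥ U)` with given components. -/
def pair (r : L.RatSpace) (s : U.RatSpace) : (L.orthSum U).RatSpace :=
  (L.inl U).baseChange ℚ r + (L.inr U).baseChange ℚ s

theorem formQ_pair (r r' : L.RatSpace) (s s' : U.RatSpace) :
    (L.orthSum U).formQ (L.pair U r s) (L.pair U r' s') = L.formQ r r' + U.formQ s s' := by
  simp only [pair, map_add, LinearMap.add_apply]
  rw [formQ_baseChange (form_inl_inl L U), formQ_baseChange (form_inr_inr L U),
    formQ_baseChange_eq_zero (form_inl_inr L U), formQ_baseChange_eq_zero (form_inr_inl L U)]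
  ring

theorem toRat_eq_pair (x : L.orthSum U) : (L.orthSum U).toRat x =
    L.pair U (L.toRat (L.fst U x)) (U.toRat (L.snd U x)) := by
  conv_lhs => rw [← L.inl_fst_add_inr_snd U x]
  rw [toRat_add]
  rfl

theorem exists_eq_pair (t : (L.orthSum U).RatSpace) : ∃ r s, t = L.pair U r s := by
  induction t using TensorProduct.induction_on with
  | zero => exact ⟨0, 0, by simp [pair]⟩
  | add a b ha hb =>
    obtain ⟨r, s, rfl⟩ := ha
    obtain ⟨r', s', rfl⟩ := hb
    exact ⟨r + r', s + s', by simp only [pair, map_add]; abel⟩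
  | tmul q x =>
    refine ⟨q ⊗ₜ L.fst U x, q ⊗ₜ L.snd U x, ?_⟩
    conv_lhs => rw [← L.inl_fst_add_inr_snd U x, TensorProduct.tmul_add]
    rfl

theorem pair_add (r r' : L.RatSpace) (s s' : U.RatSpace) :
    L.pair U r s + L.pair U r' s' = L.pair U (r + r') (s + s') := by
  simp only [pair, map_add]
  abel

theorem fst_pair (r : L.RatSpace) (s : U.RatSpace) :
    (L.fst U).baseChange ℚ (L.pair U r s) = r := by
  have h1 : L.fst U ∘ₗ L.inl U = LinearMap.id := LinearMap.ext (L.fst_inl U)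
  have h2 : L.fst U ∘ₗ L.inr U = 0 := LinearMap.ext (L.fst_inr U)
  rw [pair, map_add, baseChange_comp_apply, baseChange_comp_apply, h1, h2]
  simp

theorem snd_pair (r : L.RatSpace) (s : U.RatSpace) :
    (L.snd U).baseChange ℚ (L.pair U r s) = s := by
  have h1 : L.snd U ∘ₗ L.inl U = 0 := LinearMap.ext (L.snd_inl U)
  have h2 : L.snd U ∘ₗ L.inr U = LinearMap.id := LinearMap.ext (L.snd_inr U)
  rw [pair, map_add, baseChange_comp_apply, baseChange_comp_apply, h1, h2]
  simp

theorem pair_inj {r r' : L.RatSpace} {s s' : U.RatSpace} (h : L.pair U r s = L.pair U r' s') :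
    r = r' ∧ s = s' :=
  ⟨by rw [← L.fst_pair U r s, h, fst_pair], by rw [← L.snd_pair U r s, h, snd_pair]⟩

theorem pair_mem_shadow_iff (r : L.RatSpace) (s : U.RatSpace) :
    L.pair U r s ∈ (L.orthSum U).shadow ↔ r ∈ L.shadow ∧ s ∈ U.shadow := by
  have key : ∀ x : L.orthSum U, (L.orthSum U).formQ (L.pair U r s) ((L.orthSum U).toRat x) -
      ((L.orthSum U).form x x : ℚ) / 2 =
      (L.formQ r (L.toRat (L.fst U x)) - (L.form (L.fst U x) (L.fst U x) : ℚ) / 2) +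
      (U.formQ s (U.toRat (L.snd U x)) - (U.form (L.snd U x) (L.snd U x) : ℚ) / 2) := fun x ↦ by
    have h1 : (L.orthSum U).form x x =
        L.form (L.fst U x) (L.fst U x) + U.form (L.snd U x) (L.snd U x) := orthSum_form L U x x
    rw [toRat_eq_pair, formQ_pair, h1]
    push_cast
    ring
  constructor
  · intro h
    constructor
    · intro x
      obtain ⟨m, hm⟩ := h (L.inl U x)
      refine ⟨m, ?_⟩
      rw [key, fst_inl, snd_inl] at hm
      simpa using hm
    · intro x
      obtain ⟨m, hm⟩ := h (L.inr U x)
      refine ⟨m, ?_⟩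
      rw [key, fst_inr, snd_inr] at hm
      simpa using hm
  · rintro ⟨hr, hs⟩ x
    obtain ⟨m, hm⟩ := hr (L.fst U x)
    obtain ⟨m', hm'⟩ := hs (L.snd U x)
    exact ⟨m + m', by rw [key, hm, hm']; push_cast; rfl⟩

variable {U}

theorem IsUnimodular.exists_shadowAdd (hU : U.IsUnimodular) (s t : U.shadow) :
    ∃ y, t = shadowAdd s y := by
  have h1 : ∀ x, ∃ d : ℤ, U.formQ (t - s) (U.toRat x) = d := fun x ↦ by
    obtain ⟨m, hm⟩ := s.2 x
    obtain ⟨m', hm'⟩ := t.2 x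
    refine ⟨m' - m, ?_⟩
    rw [map_sub, LinearMap.sub_apply, Int.cast_sub, ← hm, ← hm']
    ring
  choose d hd using h1
  let f : U →+ ℤ := AddMonoidHom.mk' d fun x y ↦ by
    have := hd (x + y)
    rw [toRat_add, map_add, hd, hd] at this
    exact_mod_cast this.symm
  obtain ⟨y, hy⟩ := hU.2 f.toIntLinearMap
  have hy' : ∀ x, U.form y x = d x := fun x ↦ LinearMap.congr_fun hy x
  refine ⟨y, ?_⟩
  obtain ⟨m, x, hm, hx⟩ := U.exists_smul_eq_toRat (t - s - U.toRat y)
  have hx0 : x = 0 := by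
    refine hU.1 ?_
    rw [map_zero]
    ext w
    have h2 : U.formQ (U.toRat x) (U.toRat w) = 0 := by
      rw [← hx, map_smul, LinearMap.smul_apply, map_sub, LinearMap.sub_apply, hd, formQ_toRat, hy',
        sub_self, smul_zero]
    rw [formQ_toRat] at h2
    exact_mod_cast h2
  rw [hx0, toRat_zero, smul_eq_zero] at hx
  have h3 := hx.resolve_left (by exact_mod_cast hm)
  ext
  rw [coe_shadowAdd]
  rw [sub_sub, sub_eq_zero] at h3
  exact h3

theorem IsUnimodular.shadow_nonempty (hU : U.IsUnimodular) : Nonempty U.shadow := by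
  let b := Module.Free.chooseBasis ℤ U
  let f : U →ₗ[ℤ] ℤ := b.constr ℤ fun i ↦ U.form (b i) (b i)
  let g : U →+ ZMod 2 := AddMonoidHom.mk' (fun x ↦ ((U.form x x : ℤ) : ZMod 2)) fun x y ↦ by
    simp only [map_add, LinearMap.add_apply, U.symm y x]
    push_cast
    linear_combination (U.form x y : ZMod 2) * CharTwo.two_eq_zero (R := ZMod 2)
  have hfg : (Int.castAddHom (ZMod 2)).toIntLinearMap ∘ₗ f = g.toIntLinearMap := by
    refine b.ext fun i ↦ ?_
    simp [f, g]
  obtain ⟨w, hw⟩ := hU.2 f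
  refine ⟨⟨(1 / 2 : ℚ) • U.toRat w, fun x ↦ ?_⟩⟩
  have h1 : ((f x : ℤ) : ZMod 2) = (U.form x x : ℤ) := LinearMap.congr_fun hfg x
  rw [ZMod.intCast_eq_intCast_iff_dvd_sub] at h1
  obtain ⟨m, hm⟩ := h1
  refine ⟨-m, ?_⟩
  have h2 : U.form w x = f x := LinearMap.congr_fun hw x
  have h3 : (U.form x x : ℚ) - f x = 2 * m := by exact_mod_cast hm
  rw [map_smul, LinearMap.smul_apply, formQ_toRat, h2, smul_eq_mul]
  push_cast
  linarith

theorem IsEven.zero_mem_shadow (hU : U.IsEven) : (0 : U.RatSpace) ∈ U.shadow := fun x ↦ by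
  obtain ⟨m, hm⟩ := hU x
  refine ⟨-m, ?_⟩
  rw [hm]
  simp

/-- The map `r ↦ (r, u)` from the shadow of `L` to the shadow of `L ⊥ U`, for a unimodular
lattice `U`. -/
def ShadowMap.ofUnimodular (hU : U.IsUnimodular) (u : U.shadow) : ShadowMap L (L.orthSum U) where
  map r := ⟨L.pair U r u, (L.pair_mem_shadow_iff U _ _).2 ⟨r.2, u.2⟩⟩
  base := L.inl U
  const := U.formQ u u
  form_base x := L.form_inl_inl U x x
  map_add r x := by
    ext
    simp only [coe_shadowAdd]
    rw [toRat_eq_pair, pair_add, fst_inl, snd_inl, toRat_zero, add_zero]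
  formQ_map r s := L.formQ_pair U r s u u
  surj s := by
    obtain ⟨s, hs⟩ := s
    obtain ⟨r, u', rfl⟩ := L.exists_eq_pair U s
    rw [pair_mem_shadow_iff] at hs
    obtain ⟨y, hy⟩ := hU.exists_shadowAdd u ⟨u', hs.2⟩
    have hy' : u' = u + U.toRat y := congrArg Subtype.val hy
    refine ⟨⟨r, hs.1⟩, L.inr U y, ?_⟩
    ext
    rw [coe_shadowAdd, toRat_eq_pair, pair_add, fst_inr, snd_inr, toRat_zero, add_zero, ← hy']
  inj r s y h := by
    have h' := congrArg Subtype.val h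
    simp only [coe_shadowAdd] at h'
    rw [toRat_eq_pair, pair_add] at h'
    obtain ⟨h1, h2⟩ := L.pair_inj U h'
    have h3 : L.snd U y = 0 := by
      apply U.toRat_injective
      rw [toRat_zero]
      exact left_eq_add.1 h2
    refine ⟨L.fst U y, Subtype.ext h1, ?_⟩
    conv_rhs => rw [← L.inl_fst_add_inr_snd U y, h3, map_zero, add_zero]

end OrthSum

theorem exists_compat {L : IntegralLattice.{u}} {M : IntegralLattice.{v}}
    {U V : IntegralLattice.{w}} (hU : U.IsUnimodular) (hV : V.IsUnimodular) (s : U.shadow)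
    (t : V.shadow) (h : (L.orthSum U).Isomorphic (M.orthSum V)) :
    ∃ Ψ : L.W ≃ₗ[ℂ] M.W, Compat Ψ (V.formQ t t - U.formQ s s) := by
  obtain ⟨f, hf⟩ := h
  have h1 := (ShadowMap.ofUnimodular L hU s).compat_equiv
  have h2 := (ShadowMap.ofIsometry f hf).compat_equiv
  have h3 := (ShadowMap.ofUnimodular M hV t).compat_equiv
  have h4 := (h1.symm.trans h2.symm).trans h3
  have h5 : V.formQ t t - U.formQ s s = -U.formQ s s + -0 + V.formQ t t := by ring
  exact ⟨_, by rw [h5]; exact h4⟩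

end IntegralLattice

/-! ### Comparison of the representations -/

theorem Mp.S_pow_eight : Mp.S ^ 8 = 1 := by
  have h : Mp.S ^ 8 = ((Mp.S * Mp.S) * (Mp.S * Mp.S)) * ((Mp.S * Mp.S) * (Mp.S * Mp.S)) := by
    simp only [pow_succ, pow_zero, one_mul, mul_assoc]
  rw [h]
  refine Mp.eq_of_root_eq ?_ UpperHalfPlane.I ?_
  · simp only [Mp.mat_mul, Mp.mat_S]
    ext i j
    fin_cases i <;> fin_cases j <;> rfl
  · rw [Mp.root_mul, Mp.root_mul, Mp.root_mul (Mp.S * Mp.S)]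
    simp only [Mp.root_S_sq, Mp.root_one]
    rw [Complex.I_mul_I]
    norm_num

theorem Mp.submonoid_eq_top {N : Submonoid Mp} (hS : Mp.S ∈ N) (hT : Mp.T ∈ N) : N = ⊤ := by
  have hSi : Mp.S⁻¹ ∈ N := by
    have : Mp.S⁻¹ = Mp.S ^ 7 := by
      rw [inv_eq_iff_mul_eq_one, ← pow_succ']
      exact Mp.S_pow_eight
    rw [this]
    exact pow_mem hS 7
  have hTi : Mp.T⁻¹ ∈ N := by
    have : Mp.T⁻¹ = Mp.S⁻¹ * Mp.T * Mp.S * Mp.T * Mp.S := by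
      rw [inv_eq_iff_mul_eq_one]
      have h : Mp.S⁻¹ * Mp.S⁻¹ * ((Mp.S * Mp.T) * (Mp.S * Mp.T) * (Mp.S * Mp.T)) = 1 := by
        rw [Mp.ST_cubed]
        group
      have h2 := congrArg (fun x ↦ Mp.T * x * Mp.T⁻¹) h
      simp only [mul_one, mul_inv_cancel] at h2
      rw [← h2]
      group
    rw [this]
    exact mul_mem (mul_mem (mul_mem (mul_mem hSi hT) hS) hT) hS
  have h := congrArg Subgroup.toSubmonoid Mp.closure_S_T
  rw [Subgroup.closure_toSubmonoid, Subgroup.top_toSubmonoid] at h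
  rw [eq_top_iff, ← h, Submonoid.closure_le]
  rintro α (hα | hα)
  · rcases hα with rfl | rfl <;> assumption
  · rw [Set.mem_inv] at hα
    rcases hα with hα | hα
    · rwa [← inv_inv α, hα]
    · rw [Set.mem_singleton_iff] at hα
      rwa [← inv_inv α, hα]

theorem chi_S_of_chi_T (χ : Mp →* ℂˣ) : χ Mp.S * χ Mp.T ^ 3 = 1 := by
  have h := congrArg χ Mp.ST_cubed
  simp only [map_mul] at h
  have h2 : χ Mp.S * χ Mp.S * (χ Mp.S * χ Mp.T ^ 3) = χ Mp.S * χ Mp.S * 1 := by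
    rw [mul_one]
    conv_rhs => rw [← h]
    ext
    push_cast
    ring
  exact mul_left_cancel h2

namespace IntegralLattice

theorem slash_smul (L : IntegralLattice.{u}) (c : ℂ) (φ : ℍ → L.CplxSpace → ℂ) (α : Mp) :
    L.slash (c • φ) α = c • L.slash φ α := by
  ext τ z
  simp only [slash, Pi.smul_apply, smul_eq_mul]
  ring

theorem IsPosDef.slash_mem_Theta {L : IntegralLattice.{u}} (h : L.IsPosDef) (α : Mp)
    {f : ℍ → L.CplxSpace → ℂ} (hf : f ∈ L.Theta) : L.slash f α ∈ L.Theta := by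
  obtain ⟨F⟩ := h.nonempty_orthFrame
  obtain ⟨φ, hφ⟩ := F.exists_thetaEquiv
  obtain ⟨c, -, hc⟩ := F.slash_S_theta
  have hmem : ∀ l : L.W, L.theta l.1 ∈ L.Theta := fun l ↦ hφ l ▸ (φ l).2
  have hex : ∀ f ∈ L.Theta, ∃ l : L.W, f = L.theta l.1 := fun f hf ↦
    ⟨φ.symm ⟨f, hf⟩, by rw [← hφ, LinearEquiv.apply_symm_apply]⟩
  let N : Submonoid Mp :=
    { carrier := {α | ∀ f ∈ L.Theta, L.slash f α ∈ L.Theta}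
      one_mem' := fun f hf ↦ by rwa [slash_one]
      mul_mem' := fun {α β} hα hβ f hf ↦ by
        rw [slash_mul]
        exact hβ _ (hα _ hf) }
  have hN : N = ⊤ := by
    refine Mp.submonoid_eq_top (fun f hf ↦ ?_) fun f hf ↦ ?_
    · obtain ⟨l, rfl⟩ := hex f hf
      rw [hc]
      exact L.Theta.smul_mem _ (hmem _)
    · obtain ⟨l, rfl⟩ := hex f hf
      rw [slash_T_theta]
      exact hmem _
  have : α ∈ N := hN ▸ Submonoid.mem_top α
  exact this f hf

/-- The space of theta functions as a subrepresentation. -/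
abbrev IsPosDef.thetaRep {L : IntegralLattice.{u}} (h : L.IsPosDef) :
    Subrepresentation L.slashRep where
  toSubmodule := L.Theta
  apply_mem_toSubmodule α _ hf := h.slash_mem_Theta α⁻¹ hf

variable {L : IntegralLattice.{u}} {M : IntegralLattice.{v}}

/-- A compatible isomorphism of the spaces `W` induces an isomorphism of the spaces of theta
functions that commutes with the action up to a character. -/
theorem exists_intertwiner (hL : L.IsPosDef) (hM : M.IsPosDef) {Ψ : L.W ≃ₗ[ℂ] M.W} {k : ℚ}
    (hΨ : Compat Ψ k) : ∃ Φ : L.Theta ≃ₗ[ℂ] M.Theta,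
      (Nontrivial L.Theta → e ((k / 2 : ℚ)) = e ((L.rank : ℂ) / 8) * e (-((M.rank : ℂ) / 8))) ∧
      ∀ χ : Mp →* ℂˣ, (χ Mp.T : ℂ) = e ((k / 2 : ℚ)) → ∀ (α : Mp) (f : L.Theta),
        Φ ⟨L.slash f α, hL.slash_mem_Theta α f.2⟩ =
          (χ α : ℂ) • ⟨M.slash (Φ f) α, hM.slash_mem_Theta α (Φ f).2⟩ := by
  obtain ⟨F⟩ := hL.nonempty_orthFrame
  obtain ⟨G⟩ := hM.nonempty_orthFrame
  obtain ⟨φ, hφ⟩ := F.exists_thetaEquiv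
  obtain ⟨ψ, hψ⟩ := G.exists_thetaEquiv
  obtain ⟨c, hc0, hc⟩ := F.slash_S_theta
  obtain ⟨d, hd0, hd⟩ := G.slash_S_theta
  let A : Mp → L.Theta → L.Theta := fun α f ↦ ⟨L.slash f α, hL.slash_mem_Theta α f.2⟩
  let B : Mp → M.Theta → M.Theta := fun α f ↦ ⟨M.slash f α, hM.slash_mem_Theta α f.2⟩
  have hA : ∀ α β f, A (α * β) f = A β (A α f) := fun α β f ↦ Subtype.ext (L.slash_mul f α β)
  have hB : ∀ α β f, B (α * β) f = B β (B α f) := fun α β f ↦ Subtype.ext (M.slash_mul f α β)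
  have hA1 : ∀ f, A 1 f = f := fun f ↦ Subtype.ext (L.slash_one f)
  have hB1 : ∀ f, B 1 f = f := fun f ↦ Subtype.ext (M.slash_one f)
  have hBs : ∀ (a : ℂ) α f, B α (a • f) = a • B α f := fun a α f ↦
    Subtype.ext (M.slash_smul a f α)
  have hAT : ∀ l, A Mp.T (φ l) = φ (opT l) := fun l ↦ Subtype.ext <| by
    change L.slash (φ l) Mp.T = _
    rw [hφ, hφ, slash_T_theta]
  have hBT : ∀ l, B Mp.T (ψ l) = ψ (opT l) := fun l ↦ Subtype.ext <| by
    change M.slash (ψ l) Mp.T = _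
    rw [hψ, hψ, slash_T_theta]
  have hAS : ∀ l, A Mp.S (φ l) = ((c : ℂ) * e (-(L.rank / 8))) • φ (opD l) := fun l ↦
    Subtype.ext <| by
      change L.slash (φ l) Mp.S = _ • (φ (opD l) : ℍ → L.CplxSpace → ℂ)
      rw [hφ, hφ, hc]
  have hBS : ∀ l, B Mp.S (ψ l) = ((d : ℂ) * e (-(M.rank / 8))) • ψ (opD l) := fun l ↦
    Subtype.ext <| by
      change M.slash (ψ l) Mp.S = _ • (ψ (opD l) : ℍ → M.CplxSpace → ℂ)
      rw [hψ, hψ, hd]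
  let Φ : L.Theta ≃ₗ[ℂ] M.Theta := (φ.symm.trans Ψ).trans ψ
  have hΦ : ∀ l, Φ (φ l) = ψ (Ψ l) := fun l ↦ by simp [Φ]
  set t : ℂ := e ((k / 2 : ℚ)) with ht
  let s : ℂ := (c : ℂ) * e (-(L.rank / 8)) * e (-k) * ((d : ℂ) * e (-(M.rank / 8)))⁻¹
  have hd' : (d : ℂ) ≠ 0 := by exact_mod_cast hd0.ne'
  have hc' : (c : ℂ) ≠ 0 := by exact_mod_cast hc0.ne'
  have hs0 : s ≠ 0 := by
    simp only [s, ne_eq, mul_eq_zero, inv_eq_zero, e_ne_zero, hd', hc', or_self, not_false_eq_true]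
  have hΦT : ∀ f, Φ (A Mp.T f) = t • B Mp.T (Φ f) := fun f ↦ by
    obtain ⟨l, rfl⟩ := φ.surjective f
    rw [hAT, hΦ, hΦ, hBT, hΨ.1, map_smul]
  have hΦS : ∀ f, Φ (A Mp.S f) = s • B Mp.S (Φ f) := fun f ↦ by
    obtain ⟨l, rfl⟩ := φ.surjective f
    rw [hAS, map_smul, hΦ, hΦ, hBS, hΨ.2, map_smul, smul_smul, smul_smul]
    congr 1
    have := e_ne_zero (-((M.rank : ℂ) / 8))
    simp only [s]
    field_simp
  have hrel : Nontrivial L.Theta → s * t ^ 3 = 1 := by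
    intro hn
    obtain ⟨f, hf⟩ := exists_ne (0 : L.Theta)
    have h1 : Φ (A ((Mp.S * Mp.T) * (Mp.S * Mp.T) * (Mp.S * Mp.T)) f) =
        (s * t * (s * t) * (s * t)) •
          B ((Mp.S * Mp.T) * (Mp.S * Mp.T) * (Mp.S * Mp.T)) (Φ f) := by
      simp only [hA, hB, hΦT, hΦS, hBs, smul_smul]
      congr 1
      ring
    have h2 : Φ (A (Mp.S * Mp.S) f) = (s * s) • B (Mp.S * Mp.S) (Φ f) := by
      simp only [hA, hB, hΦS, hBs, smul_smul]
    rw [Mp.ST_cubed, h2] at h1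
    have h3 : B (Mp.S * Mp.S) (Φ f) ≠ 0 := fun h0 ↦ by
      have h4 := hB (Mp.S * Mp.S) (Mp.S * Mp.S)⁻¹ (Φ f)
      rw [mul_inv_cancel, hB1, h0, ← zero_smul ℂ (0 : M.Theta), hBs, zero_smul] at h4
      exact hf (Φ.map_eq_zero_iff.1 h4)
    have h5 := smul_left_injective ℂ h3 h1
    have h6 : s * s * (s * t ^ 3) = s * s * 1 := by
      rw [mul_one]
      conv_rhs => rw [h5]
      ring
    exact mul_left_cancel₀ (mul_ne_zero hs0 hs0) h6
  refine ⟨Φ, fun hn ↦ ?_, fun χ hχ ↦ ?_⟩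
  · have h1 := hrel hn
    have h2 : s * t ^ 3 = (c / d : ℝ) *
        (t * (e (-((L.rank : ℂ) / 8)) * e ((M.rank : ℂ) / 8))) := by
      have hk : e (-k) = (t * t)⁻¹ := by
        rw [ht, ← e_add, ← e_neg]
        congr 1
        push_cast
        ring
      have ht0 : t ≠ 0 := e_ne_zero _
      simp only [s]
      have := e_ne_zero ((M.rank : ℂ) / 8)
      rw [hk, e_neg (M.rank / 8)]
      push_cast
      field_simp
    have hnorm : ∀ q : ℚ, ∀ x : ℂ, x = q → ‖e x‖ = 1 := fun q x h ↦ h ▸ norm_e_ratCast q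
    have h3 : ‖t * (e (-((L.rank : ℂ) / 8)) * e ((M.rank : ℂ) / 8))‖ = 1 := by
      rw [norm_mul, norm_mul, hnorm (-((L.rank : ℚ) / 8)) (-((L.rank : ℂ) / 8)) (by push_cast; rfl),
        hnorm ((M.rank : ℚ) / 8) ((M.rank : ℂ) / 8) (by push_cast; rfl), ht, norm_e_ratCast]
      norm_num
    have h4 : (c / d : ℝ) = 1 := by
      have h5 := congrArg norm (h2.symm.trans h1)
      rwa [norm_mul, h3, mul_one, norm_one, Complex.norm_real, Real.norm_of_nonneg
        (div_pos hc0 hd0).le] at h5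
    rw [h1, h4, Complex.ofReal_one, one_mul] at h2
    have h6 : t * (e (-((L.rank : ℂ) / 8)) * e ((M.rank : ℂ) / 8)) *
        (e ((L.rank : ℂ) / 8) * e (-((M.rank : ℂ) / 8))) = t := by
      rw [e_neg, e_neg]
      have := e_ne_zero ((L.rank : ℂ) / 8)
      have := e_ne_zero ((M.rank : ℂ) / 8)
      field_simp
    rw [← h2, one_mul] at h6
    exact h6.symm
  · rcases subsingleton_or_nontrivial L.Theta with hsub | hn
    · have : Subsingleton M.Theta := Φ.symm.injective.subsingleton
      exact fun α f ↦ Subsingleton.elim _ _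
    have hχS : (χ Mp.S : ℂ) = s := by
      have h1 := congrArg Units.val (chi_S_of_chi_T χ)
      push_cast at h1
      rw [hχ] at h1
      exact mul_right_cancel₀ (pow_ne_zero 3 (e_ne_zero _)) (h1.trans (hrel hn).symm)
    let N : Submonoid Mp :=
      { carrier := {α | ∀ f, Φ (A α f) = (χ α : ℂ) • B α (Φ f)}
        one_mem' := fun f ↦ by rw [hA1, hB1, map_one, Units.val_one, one_smul]
        mul_mem' := fun {α β} hα hβ f ↦ by
          rw [hA, hB, hβ, hα, hBs, smul_smul, map_mul, Units.val_mul, mul_comm] }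
    have hN : N = ⊤ := by
      refine Mp.submonoid_eq_top (fun f ↦ ?_) fun f ↦ ?_
      · rw [hχS, hΦS]
      · rw [hχ, hΦT]
    intro α f
    have : α ∈ N := hN ▸ Submonoid.mem_top α
    exact this f

/-- The form of `exists_intertwiner` for the left actions. -/
theorem intertwiner_rep (hL : L.IsPosDef) (hM : M.IsPosDef) {Φ : L.Theta ≃ₗ[ℂ] M.Theta}
    {χ : Mp →* ℂˣ} (h : ∀ (α : Mp) (f : L.Theta),
        Φ ⟨L.slash f α, hL.slash_mem_Theta α f.2⟩ =
          (χ α : ℂ) • ⟨M.slash (Φ f) α, hM.slash_mem_Theta α (Φ f).2⟩) (α : Mp) (f : L.Theta) :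
    Φ (hL.thetaRep.toRepresentation α f) =
      ((χ α)⁻¹ : ℂˣ).val • hM.thetaRep.toRepresentation α (Φ f) := by
  rw [← map_inv]
  exact h α⁻¹ f

theorem StablyEquivalent.nonempty_equiv (hL : L.IsPosDef) (hM : M.IsPosDef)
    (h : L.StablyEquivalent M) :
    Nonempty ((hL.thetaRep.toRepresentation.tprod (charRep (epsilon ^ (3 * L.rank)))).Equiv
      (hM.thetaRep.toRepresentation.tprod (charRep (epsilon ^ (3 * M.rank))))) := by
  obtain ⟨U, V, hU, hV, hiso⟩ := h
  obtain ⟨s⟩ := hU.shadow_nonempty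
  obtain ⟨t⟩ := hV.shadow_nonempty
  obtain ⟨Ψ, hΨ⟩ := exists_compat hU hV s t hiso
  obtain ⟨Φ, hk, hΦ⟩ := exists_intertwiner hL hM hΨ
  have key : ∀ (α : Mp) (f : L.Theta),
      ((epsilon ^ (3 * L.rank)) α : ℂ) • Φ (hL.thetaRep.toRepresentation α f) =
        ((epsilon ^ (3 * M.rank)) α : ℂ) • hM.thetaRep.toRepresentation α (Φ f) := by
    rcases subsingleton_or_nontrivial L.Theta with hsub | hn
    · have : Subsingleton M.Theta := Φ.symm.injective.subsingleton
      exact fun α f ↦ Subsingleton.elim _ _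
    intro α f
    have hχ := intertwiner_rep hL hM
      (hΦ (epsilon ^ (3 * L.rank) * (epsilon ^ (3 * M.rank))⁻¹) ?_) α f
    · rw [hχ, smul_smul, ← Units.val_mul]
      congr 2
      simp
    · have he : ∀ n : ℕ, e (1 / 24) ^ (3 * n) = e ((n : ℂ) / 8) := fun n ↦ by
        rw [← e_nat_mul]
        congr 1
        push_cast
        ring
      rw [hk hn, e_neg, ← he, ← he, ← epsilon_T]
      simp
  refine ⟨Representation.Equiv.mk (TensorProduct.congr Φ (LinearEquiv.refl ℂ ℂ)) fun α ↦ ?_⟩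
  refine TensorProduct.ext' fun f x ↦ ?_
  have h1 : ∀ (χ : Mp →* ℂˣ), charRep χ α x = (χ α : ℂ) • x := fun χ ↦ rfl
  change Φ (hL.thetaRep.toRepresentation α f) ⊗ₜ[ℂ] (charRep (epsilon ^ (3 * L.rank)) α x) =
    (hM.thetaRep.toRepresentation α (Φ f)) ⊗ₜ[ℂ] (charRep (epsilon ^ (3 * M.rank)) α x)
  rw [h1, h1, TensorProduct.tmul_smul, TensorProduct.tmul_smul, TensorProduct.smul_tmul',
    TensorProduct.smul_tmul']
  exact congrArg (· ⊗ₜ[ℂ] x) (key α f)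

theorem EvenStablyEquivalent.nonempty_equiv (hL : L.IsPosDef) (hM : M.IsPosDef)
    (h : L.EvenStablyEquivalent M) :
    Nonempty (hL.thetaRep.toRepresentation.Equiv hM.thetaRep.toRepresentation) := by
  obtain ⟨U, V, ⟨hU, hU2⟩, ⟨hV, hV2⟩, hiso⟩ := h
  obtain ⟨Ψ, hΨ⟩ := exists_compat hU hV ⟨0, hU2.zero_mem_shadow⟩ ⟨0, hV2.zero_mem_shadow⟩ hiso
  obtain ⟨Φ, -, hΦ⟩ := exists_intertwiner hL hM hΨ
  refine ⟨Representation.Equiv.mk Φ fun α ↦ LinearMap.ext fun f ↦ ?_⟩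
  have := intertwiner_rep hL hM (hΦ 1 (by simp [e_zero])) α f
  simpa using! this

end IntegralLattice

end

end LatticeTheta

theorem theorem2p6 (L₁ : LatticeTheta.IntegralLattice.{u}) (L₂ : LatticeTheta.IntegralLattice.{v})
    (h₁ : L₁.IsPosDef) (h₂ : L₂.IsPosDef) :
    ∃ (Θ₁ : Subrepresentation L₁.slashRep) (Θ₂ : Subrepresentation L₂.slashRep),
      Θ₁.toSubmodule = L₁.Theta ∧ Θ₂.toSubmodule = L₂.Theta ∧
      (L₁.StablyEquivalent L₂ →
        Nonempty ((Θ₁.toRepresentation.tprod (LatticeTheta.charRep (LatticeTheta.epsilon ^ (3 * L₁.rank)))).Equiv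
          (Θ₂.toRepresentation.tprod (LatticeTheta.charRep (LatticeTheta.epsilon ^ (3 * L₂.rank)))))) ∧
      (L₁.EvenStablyEquivalent L₂ →
        Nonempty (Θ₁.toRepresentation.Equiv Θ₂.toRepresentation)) :=
  ⟨h₁.thetaRep, h₂.thetaRep, rfl, rfl,
    fun h ↦ h.nonempty_equiv h₁ h₂, fun h ↦ h.nonempty_equiv h₁ h₂⟩
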